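/- Let $N\ge 3$ be an integer and let $p,q>0$ satisfy $\frac1{p+1}+\frac1{q+1}=\frac{N-2}{N}$. Let $(u,v)$ be the radial profiles, $U(x)=u(|x|)$, $V(x)=v(|x|)$, of a radial ground state of $-\Delta U=V^p$, $-\Delta V=U^q$ in $\mathbb R^N$; that is, $u,v\in C^2[0,\infty)$ are positive on $[0,\infty)$, $u'(0)=v'(0)=0$, $$-u''-\tfrac{N-1}{r}u'=v^p,\qquad -v''-\tfrac{N-1}{r}v'=u^q\qquad\text{in }(0,\infty),$$ and $u\in\mathcal E_0^{\frac{p+1}p}$, $v\in\mathcal E_0^{\frac{q+1}q}$. Here, for an integer $\ell\ge0$, $\mathcal E_\ell^s$ is the completion of $r^\ell C_c^2[0,\infty)$ with respect to $$\|f\|_{\mathcal E_\ell^s}=\Bigl(\int_0^\infty\Bigl|f''+\tfrac{N-1}{r}f'-\tfrac{\ell(\ell+N-2)}{r^2}f\Bigr|^s r^{N-1}\,dr\Bigr)^{1/s},$$ realized as a space of functions on $(0,\infty)$: $f\in\mathcal E_\ell^s$ if $f$ is the almost everywhere limit of a sequence in $r^\ell C^2_c[0,\infty)$ that is Cauchy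 for this norm. Let $\ell\ge 0$ be an integer and let real-valued $(\psi,\phi)\in\mathcal E_\ell^{\frac{p+1}p}\times\mathcal E_\ell^{\frac{q+1}q}$, with $\psi,\phi\in C^2(0,\infty)$, solve $$-\psi''-\tfrac{N-1}{r}\psi'+\tfrac{\ell(\ell+N-2)}{r^2}\psi=p\,v^{p-1}\phi,\qquad -\phi''-\tfrac{N-1}{r}\phi'+\tfrac{\ell(\ell+N-2)}{r^2}\phi=q\,u^{q-1}\psi\qquad\text{in }(0,\infty),$$ and suppose that the limits $\lim_{r\to0}r^{-\ell}\psi(r)$ and $\lim_{r\to0}r^{-\ell}\phi(r)$ exist (in $\mathbb R$) and that $\lim_{r\to0}(r^{-\ell}\psi)'(r)=\lim_{r\to0}(r^{-\ell}\phi)'(r)=0$. Then, on $(0,\infty)$: (a) if $\ell=0$, then $(\psi,\phi)$ is a constant multiple of $\bigl(ru'+\frac{2(p+1)}{pq-1}u,\ rv'+\frac{2(q+1)}{pq-1}v\bigr)$; (b) if $\ell=1$, then $(\psi,\phi)$ is a constant multiple of $(u',v')$; (c) if $\ell\ge2$, then $(\psi,\phi)\equiv0$. -/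

import Mathlib

open Set Filter Topology MeasureTheory
open scoped ENNReal

namespace LaneEmden

/-- The radial part of the Laplacian on `ℝ^N` in the sector of spherical harmonics of degree `ℓ`:
`f'' + (N - 1) / r * f' - ℓ (ℓ + N - 2) / r ^ 2 * f`. It is only used at points `r > 0`. -/
noncomputable def radialLaplacian (N ℓ : ℕ) (f : ℝ → ℝ) (r : ℝ) : ℝ :=
  deriv (deriv f) r + ((N : ℝ) - 1) / r * deriv f r
    - (ℓ : ℝ) * ((ℓ : ℝ) + (N : ℝ) - 2) / r ^ 2 * f r

/-- The (possibly infinite) norm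
`(∫_0^∞ |f'' + (N-1)/r f' - ℓ(ℓ+N-2)/r² f|^s r^(N-1) dr)^(1/s)`. -/
noncomputable def energyNorm (N ℓ : ℕ) (s : ℝ) (f : ℝ → ℝ) : ℝ≥0∞ :=
  (∫⁻ r in Ioi (0 : ℝ), ‖radialLaplacian N ℓ f r‖ₑ ^ s * ENNReal.ofReal (r ^ (N - 1))) ^ (1 / s)

/-- `C²_c[0,∞)`: twice continuously differentiable on the closed half-line (one-sided derivatives
at `0`), vanishing for large `r`; no condition is imposed at `r = 0`. -/
def IsC2cHalfLine (g : ℝ → ℝ) : Prop :=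
  ContDiffOn ℝ 2 g (Ici 0) ∧ ∃ R : ℝ, ∀ r, R < r → g r = 0

/-- Membership of a function on `(0,∞)` in the completion of `r^ℓ C²_c[0,∞)` with respect to
`energyNorm N ℓ s`, realized as a function space: `f` is the almost everywhere limit of a sequence
in `r^ℓ C²_c[0,∞)` which is Cauchy for the norm. For `1 < s < N / 2` the Sobolev inequality makes
this the usual realization: a Cauchy sequence converges in `L^(s*)(r^(N-1) dr)`,
`1 / s* = 1 / s - 2 / N`, and the limit determines, and is determined by, the element of the
completion. -/
def MemEnergySpace (N ℓ : ℕ) (s : ℝ) (f : ℝ → ℝ) : Prop :=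
  ∃ g : ℕ → ℝ → ℝ,
    (∀ n, IsC2cHalfLine (g n)) ∧
    Tendsto (fun k : ℕ × ℕ =>
      energyNorm N ℓ s (fun r => r ^ ℓ * g k.1 r - r ^ ℓ * g k.2 r)) atTop (𝓝 0) ∧
    ∀ᵐ r ∂(volume.restrict (Ioi (0 : ℝ))),
      Tendsto (fun n => r ^ ℓ * g n r) atTop (𝓝 (f r))

/-- `(u, v)` is the pair of radial profiles, `U x = u |x|` and `V x = v |x|`, of a radial ground
state of `-ΔU = V^p`, `-ΔV = U^q` on `ℝ^N`: a positive classical solution, regular at the origin,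
in the energy space. (Minimality of the associated quotient is not required, so that every
radial ground state is covered.) -/
structure IsGroundStateProfile (N : ℕ) (p q : ℝ) (u v : ℝ → ℝ) : Prop where
  contDiffOn_u : ContDiffOn ℝ 2 u (Ici 0)
  contDiffOn_v : ContDiffOn ℝ 2 v (Ici 0)
  pos_u : ∀ r, 0 ≤ r → 0 < u r
  pos_v : ∀ r, 0 ≤ r → 0 < v r
  deriv_u_zero : derivWithin u (Ici 0) 0 = 0
  deriv_v_zero : derivWithin v (Ici 0) 0 = 0
  eq_u : ∀ r, 0 < r → - deriv (deriv u) r - ((N : ℝ) - 1) / r * deriv u r = v r ^ p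
  eq_v : ∀ r, 0 < r → - deriv (deriv v) r - ((N : ℝ) - 1) / r * deriv v r = u r ^ q
  mem_u : MemEnergySpace N 0 ((p + 1) / p) u
  mem_v : MemEnergySpace N 0 ((q + 1) / q) v

/-- `(ψ, φ)` is a classical solution on `(0,∞)` of the system obtained by linearizing at `(u, v)`
and restricting to spherical harmonics of degree `ℓ`. -/
structure IsLinearizedSolution (N ℓ : ℕ) (p q : ℝ) (u v ψ φ : ℝ → ℝ) : Prop where
  contDiffOn_fst : ContDiffOn ℝ 2 ψ (Ioi 0)
  contDiffOn_snd : ContDiffOn ℝ 2 φ (Ioi 0)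
  eq_fst : ∀ r, 0 < r →
    - deriv (deriv ψ) r - ((N : ℝ) - 1) / r * deriv ψ r
      + (ℓ : ℝ) * ((ℓ : ℝ) + (N : ℝ) - 2) / r ^ 2 * ψ r = p * v r ^ (p - 1) * φ r
  eq_snd : ∀ r, 0 < r →
    - deriv (deriv φ) r - ((N : ℝ) - 1) / r * deriv φ r
      + (ℓ : ℝ) * ((ℓ : ℝ) + (N : ℝ) - 2) / r ^ 2 * φ r = q * u r ^ (q - 1) * ψ r

/-- `lim_{r → 0} r^(-ℓ) f(r)` exists and `lim_{r → 0} (r^(-ℓ) f)'(r) = 0`. -/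
def RegularAtOrigin (ℓ : ℕ) (f : ℝ → ℝ) : Prop :=
  (∃ a : ℝ, Tendsto (fun r => f r / r ^ ℓ) (𝓝[>] 0) (𝓝 a)) ∧
    Tendsto (deriv (fun r => f r / r ^ ℓ)) (𝓝[>] 0) (𝓝 0)

end LaneEmden

namespace LaneEmden

/-! Dividing by `r^ℓ` turns the degree `ℓ` sector in dimension `N` into a radial system in dimension
`N + 2ℓ`, of the form `-Δf = a g`, `-Δg = b f` with `a = p v^(p-1) > 0` and `b = q u^(q-1) > 0`.
Membership in the energy space enters only through decay: functions in `𝓔_ℓ^s` are `O(r^(2-N/s))` at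
infinity, and on the critical hyperbola this rate is `r^(-N/(q+1))` for the first component and
`r^(-N/(p+1))` for the second.

For `ℓ = 0` and `ℓ = 1` a decaying solution is known, generated by dilations and by translations,
and its first component does not vanish at the origin. Subtracting a multiple of it makes the first
component of a given solution start from `0`. If the second component then starts from a nonzero
value, positivity of the coefficients pushes the first one monotonically away from `0`
(`snd_neg_of_start`), against decay. So both start from `0`, and a Picard iteration
(`eq_zero_of_start`) gives the zero solution. This is `exists_eq_const_mul`.

For `ℓ ≥ 2` the positive pair `(-u'/r, -v'/r)` solves the same system in dimension `N + 2`, whereas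
`(ψ, φ)/r^ℓ` solves it in the larger dimension `N + 2ℓ`, where the suitably weighted Newtonian
potential is strictly smaller. Pairing each solution with the source of the other gives a closed
chain of inequalities, hence equalities, and strictness forces the solution to vanish
(`eq_zero_of_pos_solution`). The chain is informative only if the pairing is finite, which is where
the critical decay rate is used (`lintegral_pairing_ne_top`). -/

/-! ### Radial Poisson equations in flux form. -/

/-- `f` is a radial solution of `-Δ f = h` on `ℝ^(m+1)` away from the origin, with derivative `f'`,
whose flux through small spheres tends to zero. -/
structure RadialPoisson (m : ℕ) (f f' h : ℝ → ℝ) : Prop where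
  hasDerivAt : ∀ r, 0 < r → HasDerivAt f (f' r) r
  hasDerivAt_flux : ∀ r, 0 < r → HasDerivAt (fun r => r ^ m * f' r) (-(r ^ m * h r)) r
  flux_zero : Tendsto (fun r => r ^ m * f' r) (𝓝[>] 0) (𝓝 0)

lemma RadialPoisson.sub_smul {m : ℕ} {f f' h f₁ f₁' h₁ : ℝ → ℝ}
    (H : RadialPoisson m f f' h) (H₁ : RadialPoisson m f₁ f₁' h₁) (c : ℝ) :
    RadialPoisson m (fun r => f r - c * f₁ r) (fun r => f' r - c * f₁' r)
      (fun r => h r - c * h₁ r) where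
  hasDerivAt r hr := (H.hasDerivAt r hr).sub ((H₁.hasDerivAt r hr).const_mul c)
  hasDerivAt_flux r hr := by
    refine (((H.hasDerivAt_flux r hr).sub ((H₁.hasDerivAt_flux r hr).const_mul c)).congr_deriv
      (by ring)).congr_of_eventuallyEq (.of_forall fun x => ?_)
    simp only [Pi.sub_apply]
    ring
  flux_zero := by
    convert H.flux_zero.sub (H₁.flux_zero.const_mul c) using 2
    · ring
    · simp

lemma RadialPoisson.neg {m : ℕ} {f f' h : ℝ → ℝ} (H : RadialPoisson m f f' h) :
    RadialPoisson m (fun r => -f r) (fun r => -f' r) (fun r => -h r) where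
  hasDerivAt r hr := (H.hasDerivAt r hr).neg
  hasDerivAt_flux r hr := by
    refine ((H.hasDerivAt_flux r hr).neg.congr_deriv (by ring)).congr_of_eventuallyEq
      (.of_forall fun x => ?_)
    simp only [Pi.neg_apply]
    ring
  flux_zero := by
    convert H.flux_zero.neg using 2
    · ring
    · simp

lemma RadialPoisson.congr_right {m : ℕ} {f f' h k : ℝ → ℝ} (H : RadialPoisson m f f' h)
    (hk : ∀ r, 0 < r → h r = k r) : RadialPoisson m f f' k where
  hasDerivAt := H.hasDerivAt
  hasDerivAt_flux r hr := hk r hr ▸ H.hasDerivAt_flux r hr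
  flux_zero := H.flux_zero

lemma RadialPoisson.continuousOn {m : ℕ} {f f' h : ℝ → ℝ} (H : RadialPoisson m f f' h) :
    ContinuousOn f (Ioi 0) :=
  fun r hr => (H.hasDerivAt r hr).continuousAt.continuousWithinAt

/-! ### Comparison from the origin and shooting for cooperative systems. -/

lemma lt_limit_of_deriv_neg {F F' : ℝ → ℝ} {R c : ℝ}
    (hF : ∀ r ∈ Ioo 0 R, HasDerivAt F (F' r) r) (hneg : ∀ r ∈ Ioo 0 R, F' r < 0)
    (hc : Tendsto F (𝓝[>] 0) (𝓝 c)) : ∀ r ∈ Ioo 0 R, F r < c := by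
  have hanti : StrictAntiOn F (Ioo 0 R) := by
    refine strictAntiOn_of_deriv_neg (convex_Ioo 0 R)
      (fun x hx => (hF x hx).continuousAt.continuousWithinAt) ?_
    intro x hx
    rw [interior_Ioo] at hx
    rw [(hF x hx).deriv]
    exact hneg x hx
  intro r hr
  -- The intermediate point `r / 2` keeps the inequality strict in the limit.
  have h2 : r / 2 ∈ Ioo 0 R := ⟨by linarith [hr.1], by linarith [hr.1, hr.2]⟩
  have h3 : F r < F (r / 2) := hanti h2 hr (by linarith [hr.1])
  refine h3.trans_le (ge_of_tendsto hc ?_)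
  filter_upwards [Ioo_mem_nhdsGT h2.1] with x hx
  exact (hanti ⟨hx.1, hx.2.trans h2.2⟩ h2 hx.2).le

lemma limit_lt_of_deriv_pos {F F' : ℝ → ℝ} {R c : ℝ}
    (hF : ∀ r ∈ Ioo 0 R, HasDerivAt F (F' r) r) (hpos : ∀ r ∈ Ioo 0 R, 0 < F' r)
    (hc : Tendsto F (𝓝[>] 0) (𝓝 c)) : ∀ r ∈ Ioo 0 R, c < F r := by
  intro r hr
  have := lt_limit_of_deriv_neg (F := fun r => -F r) (F' := fun r => -F' r) (c := -c)
    (fun r hr => (hF r hr).neg) (fun r hr => by linarith [hpos r hr]) hc.neg r hr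
  linarith

lemma limit_le_of_deriv_nonneg {F F' : ℝ → ℝ} {R c : ℝ}
    (hF : ∀ r ∈ Ioo 0 R, HasDerivAt F (F' r) r) (hpos : ∀ r ∈ Ioo 0 R, 0 ≤ F' r)
    (hc : Tendsto F (𝓝[>] 0) (𝓝 c)) : ∀ r ∈ Ioo 0 R, c ≤ F r := by
  have hmono : MonotoneOn F (Ioo 0 R) := by
    refine monotoneOn_of_deriv_nonneg (convex_Ioo 0 R)
      (fun x hx => (hF x hx).continuousAt.continuousWithinAt) ?_ ?_
    · intro x hx
      rw [interior_Ioo] at hx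
      exact (hF x hx).differentiableAt.differentiableWithinAt
    · intro x hx
      rw [interior_Ioo] at hx
      rw [(hF x hx).deriv]
      exact hpos x hx
  intro r hr
  refine le_of_tendsto hc ?_
  filter_upwards [Ioo_mem_nhdsGT hr.1] with x hx
  exact hmono ⟨hx.1, hx.2.trans hr.2⟩ hr hx.2.le

lemma abs_le_of_abs_deriv_le {F F' H H' : ℝ → ℝ} {R : ℝ}
    (hF : ∀ r ∈ Ioo 0 R, HasDerivAt F (F' r) r) (hH : ∀ r ∈ Ioo 0 R, HasDerivAt H (H' r) r)
    (hle : ∀ r ∈ Ioo 0 R, |F' r| ≤ H' r)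
    (hF0 : Tendsto F (𝓝[>] 0) (𝓝 0)) (hH0 : Tendsto H (𝓝[>] 0) (𝓝 0)) :
    ∀ r ∈ Ioo 0 R, |F r| ≤ H r := by
  intro r hr
  have h1 := limit_le_of_deriv_nonneg (F := fun r => H r - F r) (F' := fun r => H' r - F' r)
    (c := 0) (fun r hr => (hH r hr).sub (hF r hr))
    (fun r hr => by linarith [le_abs_self (F' r), hle r hr]) (by simpa using hH0.sub hF0) r hr
  have h2 := limit_le_of_deriv_nonneg (F := fun r => H r + F r) (F' := fun r => H' r + F' r)
    (c := 0) (fun r hr => (hH r hr).add (hF r hr))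
    (fun r hr => by linarith [neg_abs_le (F' r), hle r hr]) (by simpa using hH0.add hF0) r hr
  exact abs_le.2 ⟨by linarith, by linarith⟩

lemma RadialPoisson.deriv_neg_of_pos {m : ℕ} {f f' h : ℝ → ℝ} {R : ℝ}
    (H : RadialPoisson m f f' h) (hh : ∀ r ∈ Ioo 0 R, 0 < h r) : ∀ r ∈ Ioo 0 R, f' r < 0 := by
  intro r hr
  have := lt_limit_of_deriv_neg (fun r hr => H.hasDerivAt_flux r hr.1)
    (fun r hr => neg_neg_of_pos (mul_pos (pow_pos hr.1 m) (hh r hr))) H.flux_zero r hr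
  exact neg_of_mul_neg_right this (pow_pos hr.1 m).le

lemma RadialPoisson.deriv_pos_of_neg {m : ℕ} {f f' h : ℝ → ℝ} {R : ℝ}
    (H : RadialPoisson m f f' h) (hh : ∀ r ∈ Ioo 0 R, h r < 0) : ∀ r ∈ Ioo 0 R, 0 < f' r := by
  intro r hr
  have := H.neg.deriv_neg_of_pos (R := R) (fun r hr => by linarith [hh r hr]) r hr
  linarith

/-- A regular solution of a linear cooperative system which starts from `0` in the first
component and from a negative value in the second one is monotone. -/
lemma snd_neg_of_start {m : ℕ} {a b f g f' g' : ℝ → ℝ} {g₀ : ℝ}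
    (ha : ∀ r, 0 < r → 0 < a r) (hb : ∀ r, 0 < r → 0 < b r)
    (Hf : RadialPoisson m f f' (fun r => a r * g r))
    (Hg : RadialPoisson m g g' (fun r => b r * f r))
    (hf0 : Tendsto f (𝓝[>] 0) (𝓝 0)) (hg0 : Tendsto g (𝓝[>] 0) (𝓝 g₀)) (hneg : g₀ < 0) :
    ∀ r, 0 < r → g r < 0 := by
  by_contra! hcon
  obtain ⟨r₁, hr₁, hgr₁⟩ := hcon
  have hev : ∀ᶠ r in 𝓝[>] (0 : ℝ), g r < 0 := hg0.eventually_lt_const hneg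
  obtain ⟨ε, hε, hεs⟩ := (mem_nhdsGT_iff_exists_Ioo_subset).1 hev
  have hε : 0 < ε := hε
  have hεr : ε ≤ r₁ := by
    by_contra! hlt
    exact absurd (hεs ⟨hr₁, hlt⟩) (not_lt.2 hgr₁)
  have hcomp : IsCompact (Icc ε r₁ ∩ g ⁻¹' Ici 0) :=
    isCompact_Icc.of_isClosed_subset
      ((Hg.continuousOn.mono fun x hx => hε.trans_le hx.1).preimage_isClosed_of_isClosed
        isClosed_Icc isClosed_Ici) inter_subset_left
  -- `S` is the first point where `g ≥ 0`. Before it `g < 0`, so `f` increases from `0` and is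
  -- positive, so `g` decreases from `g₀ < 0` and cannot reach `0` at `S`.
  obtain ⟨S, ⟨hSI, hSg⟩, hSmin⟩ := hcomp.exists_isLeast ⟨r₁, ⟨hεr, le_rfl⟩, hgr₁⟩
  have hS : 0 < S := hε.trans_le hSI.1
  have hgneg : ∀ r ∈ Ioo 0 S, g r < 0 := by
    intro r hr
    by_cases hrε : r < ε
    · exact hεs ⟨hr.1, hrε⟩
    · by_contra! h0
      exact absurd (hSmin ⟨⟨not_lt.1 hrε, hr.2.le.trans hSI.2⟩, h0⟩) (not_le.2 hr.2)
  have hf'pos := Hf.deriv_pos_of_neg (R := S)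
    fun r hr => mul_neg_of_pos_of_neg (ha r hr.1) (hgneg r hr)
  have hfpos := limit_lt_of_deriv_pos (fun r hr => Hf.hasDerivAt r hr.1) hf'pos hf0
  have hg'neg := Hg.deriv_neg_of_pos (R := S) fun r hr => mul_pos (hb r hr.1) (hfpos r hr)
  have hglt := lt_limit_of_deriv_neg (fun r hr => Hg.hasDerivAt r hr.1) hg'neg hg0
  have hle : g S ≤ g₀ := by
    refine le_of_tendsto (((Hg.hasDerivAt S hS).continuousAt).mono_left nhdsWithin_le_nhds
      : Tendsto g (𝓝[<] S) (𝓝 (g S))) ?_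
    filter_upwards [Ioo_mem_nhdsLT hS] with x hx using (hglt x hx).le
  exact absurd (hle.trans_lt hneg) (not_lt.2 hSg)

/-- As `g` stays negative, `f` is increasing and positive, so `r^ℓ f(r) ≥ f(1) > 0` for `r ≥ 1`. -/
lemma not_tendsto_zero_of_start {m ℓ : ℕ} {a b f g f' g' : ℝ → ℝ} {g₀ : ℝ}
    (ha : ∀ r, 0 < r → 0 < a r) (hb : ∀ r, 0 < r → 0 < b r)
    (Hf : RadialPoisson m f f' (fun r => a r * g r))
    (Hg : RadialPoisson m g g' (fun r => b r * f r))
    (hf0 : Tendsto f (𝓝[>] 0) (𝓝 0)) (hg0 : Tendsto g (𝓝[>] 0) (𝓝 g₀)) (hneg : g₀ < 0) :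
    ¬ Tendsto (fun r => r ^ ℓ * f r) atTop (𝓝 0) := by
  have hgneg := snd_neg_of_start ha hb Hf Hg hf0 hg0 hneg
  have hf'pos : ∀ r, 0 < r → 0 < f' r := fun r hr =>
    Hf.deriv_pos_of_neg (R := r + 1)
      (fun r hr => mul_neg_of_pos_of_neg (ha r hr.1) (hgneg r hr.1)) r ⟨hr, by linarith⟩
  have hmono : StrictMonoOn f (Ioi 0) := by
    refine strictMonoOn_of_deriv_pos (convex_Ioi 0) Hf.continuousOn ?_
    intro x hx
    rw [interior_Ioi] at hx
    rw [(Hf.hasDerivAt x hx).deriv]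
    exact hf'pos x hx
  have hf1 : 0 < f 1 := limit_lt_of_deriv_pos (R := 2) (fun r hr => Hf.hasDerivAt r hr.1)
    (fun r hr => hf'pos r hr.1) hf0 1 ⟨one_pos, one_lt_two⟩
  intro hlim
  refine absurd (ge_of_tendsto hlim (b := f 1) ?_) (not_le.2 hf1)
  filter_upwards [eventually_ge_atTop 1] with r hr
  have h1 : f 1 ≤ f r := hmono.monotoneOn (mem_Ioi.2 one_pos) (mem_Ioi.2 (by linarith)) hr
  nlinarith [one_le_pow₀ hr (n := ℓ)]

/-! ### Uniqueness at the singular origin. -/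

lemma tendsto_const_mul_pow_succ (c : ℝ) (k : ℕ) :
    Tendsto (fun r : ℝ => c * r ^ (k + 1)) (𝓝[>] 0) (𝓝 0) := by
  have : ContinuousAt (fun r : ℝ => c * r ^ (k + 1)) 0 := by fun_prop
  simpa [ContinuousAt] using this.tendsto.mono_left nhdsWithin_le_nhds

/-- One Picard step: two integrations gain `r²` and a factor `1/((m+2k+1)(2k+2))`. Only `1/(k+1)` is
kept, which is enough to build up a factorial. -/
lemma RadialPoisson.abs_le_pow {m k : ℕ} {f f' h : ℝ → ℝ} {R C : ℝ} (hC : 0 ≤ C)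
    (H : RadialPoisson m f f' h) (hf0 : Tendsto f (𝓝[>] 0) (𝓝 0))
    (hh : ∀ r ∈ Ioo 0 R, |h r| ≤ C * r ^ (2 * k)) :
    ∀ r ∈ Ioo 0 R, |f r| ≤ C / (k + 1) * r ^ (2 * (k + 1)) := by
  have hflux : ∀ r ∈ Ioo 0 R, |r ^ m * f' r| ≤ C * r ^ (m + 2 * k + 1) := by
    refine abs_le_of_abs_deriv_le (H' := fun r => C * (((m + 2 * k + 1 : ℕ) : ℝ) * r ^ (m + 2 * k)))
      (fun r hr => H.hasDerivAt_flux r hr.1) (fun r hr => ?_) (fun r hr => ?_) H.flux_zero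
      (tendsto_const_mul_pow_succ _ _)
    · simpa using (hasDerivAt_pow (m + 2 * k + 1) r).const_mul C
    · rw [abs_neg, abs_mul, abs_of_pos (pow_pos hr.1 m)]
      have h1 : (1 : ℝ) ≤ ((m + 2 * k + 1 : ℕ) : ℝ) := by
        push_cast; linarith [m.cast_nonneg (α := ℝ), k.cast_nonneg (α := ℝ)]
      have h2 : 0 ≤ C * r ^ (m + 2 * k) := mul_nonneg hC (pow_pos hr.1 _).le
      calc r ^ m * |h r| ≤ r ^ m * (C * r ^ (2 * k)) :=
            mul_le_mul_of_nonneg_left (hh r hr) (pow_pos hr.1 m).le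
        _ = C * r ^ (m + 2 * k) := by ring
        _ ≤ C * (((m + 2 * k + 1 : ℕ) : ℝ) * r ^ (m + 2 * k)) := by nlinarith
  have hf' : ∀ r ∈ Ioo 0 R, |f' r| ≤ C * r ^ (2 * k + 1) := by
    intro r hr
    have h0 := pow_pos hr.1 m
    have := hflux r hr
    rw [abs_mul, abs_of_pos h0] at this
    refine le_of_mul_le_mul_left (this.trans_eq ?_) h0
    ring
  refine abs_le_of_abs_deriv_le (H' := fun r => 2 * C * r ^ (2 * k + 1))
      (fun r hr => H.hasDerivAt r hr.1) (fun r hr => ?_) (fun r hr => ?_) hf0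
      (tendsto_const_mul_pow_succ _ (2 * k + 1))
  · refine ((hasDerivAt_pow (2 * (k + 1)) r).const_mul (C / (k + 1))).congr_deriv ?_
    rw [show 2 * (k + 1) - 1 = 2 * k + 1 by omega]
    push_cast
    field_simp
  · have := hf' r hr
    have h2 : 0 ≤ C * r ^ (2 * k + 1) := mul_nonneg hC (pow_pos hr.1 _).le
    linarith

lemma exists_abs_le_of_tendsto {f : ℝ → ℝ} {c : ℝ} (hf : ContinuousOn f (Ioi 0))
    (hc : Tendsto f (𝓝[>] 0) (𝓝 c)) (R : ℝ) : ∃ C, 0 ≤ C ∧ ∀ r ∈ Ioo 0 R, |f r| ≤ C := by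
  have hev : ∀ᶠ r in 𝓝[>] (0 : ℝ), |f r| < |c| + 1 :=
    hc.abs.eventually_lt_const (by linarith)
  obtain ⟨ε, hε, hεs⟩ := (mem_nhdsGT_iff_exists_Ioo_subset).1 hev
  have hε : 0 < ε := hε
  obtain ⟨D, hD⟩ := (isCompact_Icc (a := ε) (b := R)).exists_bound_of_continuousOn
    (hf.mono fun x hx => hε.trans_le hx.1)
  refine ⟨max (|c| + 1) D, le_max_of_le_left (by positivity), fun r hr => ?_⟩
  by_cases h : r < ε
  · exact le_max_of_le_left (hεs ⟨hr.1, h⟩).le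
  · exact le_max_of_le_right (hD r ⟨not_lt.1 h, hr.2.le⟩)

/-- The coefficients are bounded near the origin, so iterating `abs_le_pow` bounds both components
by `D K^k r^(2k) / k!` for every `k`. -/
lemma eq_zero_of_start {m : ℕ} {a b f g f' g' : ℝ → ℝ} {a₀ b₀ : ℝ}
    (ha : ContinuousOn a (Ioi 0)) (hb : ContinuousOn b (Ioi 0))
    (ha0 : Tendsto a (𝓝[>] 0) (𝓝 a₀)) (hb0 : Tendsto b (𝓝[>] 0) (𝓝 b₀))
    (Hf : RadialPoisson m f f' (fun r => a r * g r))
    (Hg : RadialPoisson m g g' (fun r => b r * f r))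
    (hf0 : Tendsto f (𝓝[>] 0) (𝓝 0)) (hg0 : Tendsto g (𝓝[>] 0) (𝓝 0)) :
    ∀ r, 0 < r → f r = 0 ∧ g r = 0 := by
  intro r hr
  obtain ⟨A, hA0, hA⟩ := exists_abs_le_of_tendsto ha ha0 (r + 1)
  obtain ⟨B, hB0, hB⟩ := exists_abs_le_of_tendsto hb hb0 (r + 1)
  obtain ⟨F, hF0, hF⟩ := exists_abs_le_of_tendsto Hf.continuousOn hf0 (r + 1)
  obtain ⟨G, hG0, hG⟩ := exists_abs_le_of_tendsto Hg.continuousOn hg0 (r + 1)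
  set K := A + B with hK
  set D := F + G with hD
  have hK0 : 0 ≤ K := by positivity
  have hD0 : 0 ≤ D := by positivity
  have key : ∀ k : ℕ, ∀ x ∈ Ioo 0 (r + 1),
      |f x| ≤ D * (K ^ k / k.factorial) * x ^ (2 * k) ∧
      |g x| ≤ D * (K ^ k / k.factorial) * x ^ (2 * k) := by
    intro k
    induction k with
    | zero =>
      intro x hx
      simp only [pow_zero, Nat.factorial_zero, Nat.cast_one, div_one, mul_one, mul_zero]
      exact ⟨by linarith [hF x hx], by linarith [hG x hx]⟩
    | succ k ih =>
      intro x hx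
      have hC : 0 ≤ K * (D * (K ^ k / k.factorial)) := by positivity
      have e : K * (D * (K ^ k / k.factorial)) / (k + 1)
          = D * (K ^ (k + 1) / (k + 1).factorial) := by
        rw [Nat.factorial_succ]; push_cast; field_simp; ring
      rw [← e]
      constructor
      · refine Hf.abs_le_pow (R := r + 1) hC hf0 (fun y hy => ?_) x hx
        rw [abs_mul, mul_assoc]
        exact mul_le_mul (by linarith [hA y hy]) (ih y hy).2 (abs_nonneg _) hK0
      · refine Hg.abs_le_pow (R := r + 1) hC hg0 (fun y hy => ?_) x hx
        rw [abs_mul, mul_assoc]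
        exact mul_le_mul (by linarith [hB y hy]) (ih y hy).1 (abs_nonneg _) hK0
  have hlim : Tendsto (fun k : ℕ => D * (K ^ k / k.factorial) * r ^ (2 * k)) atTop (𝓝 0) := by
    have := (FloorSemiring.tendsto_pow_div_factorial_atTop (K * r ^ 2)).const_mul D
    rw [mul_zero] at this
    refine this.congr fun k => ?_
    rw [mul_pow, pow_mul]; ring
  have hr' : r ∈ Ioo 0 (r + 1) := ⟨hr, by linarith⟩
  exact ⟨abs_nonpos_iff.1 (ge_of_tendsto' hlim fun k => (key k r hr').1),
    abs_nonpos_iff.1 (ge_of_tendsto' hlim fun k => (key k r hr').2)⟩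


/-! ### Reduction to dimension `N + 2ℓ` and pointwise decay in the energy space. -/

lemma contDiffOn_two_Ioi {f : ℝ → ℝ} (hf : ContDiffOn ℝ 2 f (Ioi 0)) :
    (∀ r, 0 < r → HasDerivAt f (deriv f r) r) ∧
    (∀ r, 0 < r → HasDerivAt (deriv f) (deriv (deriv f) r) r) ∧
    ContinuousOn (deriv (deriv f)) (Ioi 0) := by
  have h1 := (contDiffOn_succ_iff_deriv_of_isOpen (n := 1) isOpen_Ioi).1 hf
  have h2 := (contDiffOn_succ_iff_deriv_of_isOpen (n := 0) isOpen_Ioi).1 h1.2.2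
  exact ⟨fun r hr => (h1.1.differentiableAt (Ioi_mem_nhds hr)).hasDerivAt,
    fun r hr => (h2.1.differentiableAt (Ioi_mem_nhds hr)).hasDerivAt, h2.2.2.continuousOn⟩

lemma continuousOn_radialLaplacian {N ℓ : ℕ} {f : ℝ → ℝ} (hf : ContDiffOn ℝ 2 f (Ioi 0)) :
    ContinuousOn (radialLaplacian N ℓ f) (Ioi 0) := by
  obtain ⟨h1, h2, h3⟩ := contDiffOn_two_Ioi hf
  have c1 : ContinuousOn f (Ioi 0) := hf.continuousOn
  have c2 : ContinuousOn (deriv f) (Ioi 0) :=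
    fun r hr => (h2 r hr).continuousAt.continuousWithinAt
  have ne : ∀ r ∈ Ioi (0 : ℝ), r ≠ 0 := fun r hr => (ne_of_gt hr)
  have ne2 : ∀ r ∈ Ioi (0 : ℝ), r ^ 2 ≠ 0 := fun r hr => pow_ne_zero 2 (ne r hr)
  unfold radialLaplacian
  exact (h3.add ((continuousOn_const.div continuousOn_id ne).mul c2)).sub
    ((continuousOn_const.div (continuousOn_id.pow 2) ne2).mul c1)

/-- Dividing by `r^ℓ` turns the degree `ℓ` sector in dimension `N` into the radial sector in
dimension `N + 2 ℓ`. -/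
lemma hasDerivAt_flux_div_pow {N ℓ : ℕ} (hN : 1 ≤ N) {f : ℝ → ℝ} (hf : ContDiffOn ℝ 2 f (Ioi 0))
    {r : ℝ} (hr : 0 < r) :
    HasDerivAt (fun r => r ^ (N - 1 + 2 * ℓ) * deriv (fun r => f r / r ^ ℓ) r)
      (r ^ (N - 1 + ℓ) * radialLaplacian N ℓ f r) r := by
  obtain ⟨h1, h2, -⟩ := contDiffOn_two_Ioi hf
  -- Removes the truncated exponent `k - 1`, which is harmless at `k = 0` because of the factor `k`.
  have pw : ∀ (k : ℕ) (x : ℝ), 0 < x → (k : ℝ) * x ^ (k - 1) = k * x ^ k / x := by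
    intro k x hx
    cases k with
    | zero => simp
    | succ k => rw [Nat.add_sub_cancel, pow_succ]; field_simp
  have e : ∀ x, 0 < x → x ^ (N - 1 + 2 * ℓ) * deriv (fun r => f r / r ^ ℓ) x
      = x ^ (N - 1 + ℓ) * (deriv f x - ℓ / x * f x) := by
    intro x hx
    have hx' := hx.ne'
    have hd := (h1 x hx).fun_div (hasDerivAt_pow ℓ x) (pow_ne_zero ℓ hx')
    rw [hd.deriv, pw ℓ x hx, show N - 1 + 2 * ℓ = N - 1 + ℓ + ℓ by ring, pow_add _ (N - 1 + ℓ) ℓ]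
    field_simp
  have hr' := hr.ne'
  have hd := (hasDerivAt_pow (N - 1 + ℓ) r).fun_mul
    ((h2 r hr).fun_sub (((hasDerivAt_inv hr').const_mul (ℓ : ℝ)).fun_mul (h1 r hr)))
  refine (hd.congr_deriv ?_).congr_of_eventuallyEq ?_
  · rw [pw _ r hr]
    unfold radialLaplacian
    push_cast [Nat.cast_sub hN]
    field_simp
    ring
  · filter_upwards [Ioi_mem_nhds hr] with x hx
    rw [e x hx]
    rfl

lemma enorm_sub_le_lintegral {F F' : ℝ → ℝ} {a b : ℝ} (ha : 0 < a) (hab : a ≤ b)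
    (hF : ∀ r, 0 < r → HasDerivAt F (F' r) r) (hc : ContinuousOn F' (Ioi 0)) :
    ‖F b - F a‖ₑ ≤ ∫⁻ x in Ioc a b, ‖F' x‖ₑ := by
  have hc' : ContinuousOn F' (uIcc a b) := by
    rw [uIcc_of_le hab]; exact hc.mono fun x hx => ha.trans_le hx.1
  have := intervalIntegral.integral_eq_sub_of_hasDerivAt (f := F) (f' := F') (a := a) (b := b)
    (fun x hx => hF x (by rw [uIcc_of_le hab] at hx; exact ha.trans_le hx.1))
    hc'.intervalIntegrable
  rw [← this, intervalIntegral.integral_of_le hab]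
  exact enorm_integral_le_lintegral_enorm _

lemma enorm_le_lintegral_of_tendsto_zero {F F' : ℝ → ℝ} {b : ℝ} (hb : 0 < b)
    (hF : ∀ r, 0 < r → HasDerivAt F (F' r) r) (hc : ContinuousOn F' (Ioi 0))
    (h0 : Tendsto F (𝓝[>] 0) (𝓝 0)) :
    ‖F b‖ₑ ≤ ∫⁻ x in Ioc 0 b, ‖F' x‖ₑ := by
  have hlim : Tendsto (fun a => ‖F b - F a‖ₑ) (𝓝[>] 0) (𝓝 ‖F b‖ₑ) := by
    have := (tendsto_const_nhds (x := F b)).sub h0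
    rw [sub_zero] at this
    exact this.enorm
  refine le_of_tendsto hlim ?_
  filter_upwards [Ioo_mem_nhdsGT hb] with a ha
  exact (enorm_sub_le_lintegral ha.1 ha.2.le hF hc).trans
    (lintegral_mono_set (Ioc_subset_Ioc_left ha.1.le))

/-- Splitting at height `lam` replaces Hölder's inequality; `lam` is free and is later chosen to
balance the two terms. -/
lemma enorm_le_add_rpow {s lam : ℝ} (hs : 1 < s) (hl : 0 < lam) (y : ℝ) :
    ‖y‖ₑ ≤ ENNReal.ofReal lam + ENNReal.ofReal (lam ^ (1 - s)) * ‖y‖ₑ ^ s := by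
  rw [Real.enorm_eq_ofReal_abs]
  rcases le_or_gt |y| lam with h | h
  · exact (ENNReal.ofReal_le_ofReal h).trans le_self_add
  · refine le_trans ?_ le_add_self
    have hy : 0 < |y| := hl.trans h
    rw [ENNReal.ofReal_rpow_of_pos hy, ← ENNReal.ofReal_mul (by positivity)]
    refine ENNReal.ofReal_le_ofReal ?_
    have h1 : |y| ^ (1 - s) ≤ lam ^ (1 - s) := Real.rpow_le_rpow_of_nonpos hl h.le (by linarith)
    calc |y| = |y| ^ (1 - s) * |y| ^ s := by
          rw [← Real.rpow_add hy]; simp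
      _ ≤ _ := mul_le_mul_of_nonneg_right h1 (by positivity)

/-- Pointwise Sobolev inequality for functions in `r^ℓ C²_c[0,∞)`. -/
lemma abs_le_of_energyNorm_le_one {N ℓ : ℕ} {s : ℝ} (hN : 2 ≤ N) (hs : 1 < s) (hsN : 2 < N / s)
    {g : ℝ → ℝ} (hg : IsC2cHalfLine g) (hE : energyNorm N ℓ s (fun r => r ^ ℓ * g r) ≤ 1)
    {r : ℝ} (hr : 0 < r) :
    |r ^ ℓ * g r| ≤ 2 / (N / s + ℓ - 2) * r ^ (2 - N / s) := by
  obtain ⟨hgC, R, hgR⟩ := hg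
  have hgC' : ContDiffOn ℝ 2 g (Ioi 0) := hgC.mono Ioi_subset_Ici_self
  have hfC : ContDiffOn ℝ 2 (fun r => r ^ ℓ * g r) (Ioi 0) := (contDiff_id.pow ℓ).contDiffOn.mul hgC'
  obtain ⟨hg1, -, -⟩ := contDiffOn_two_Ioi hgC'
  set F := radialLaplacian N ℓ (fun r => r ^ ℓ * g r) with hF
  have hFc : ContinuousOn F (Ioi 0) := continuousOn_radialLaplacian hfC
  have hflux : ∀ t, 0 < t → HasDerivAt (fun r => r ^ (N - 1 + 2 * ℓ) * deriv g r)
      (t ^ (N - 1 + ℓ) * F t) t := by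
    intro t ht
    refine (hasDerivAt_flux_div_pow (by omega) hfC ht).congr_of_eventuallyEq ?_
    filter_upwards [Ioi_mem_nhds ht] with x hx
    congr 1
    refine Filter.EventuallyEq.deriv_eq ?_
    filter_upwards [Ioi_mem_nhds hx] with y hy
    have : y ^ ℓ ≠ 0 := pow_ne_zero _ (ne_of_gt hy)
    field_simp
  have hflux0 : Tendsto (fun r => r ^ (N - 1 + 2 * ℓ) * deriv g r) (𝓝[>] 0) (𝓝 0) := by
    have h1 : ContinuousOn (derivWithin g (Ici 0)) (Ici 0) :=
      hgC.continuousOn_derivWithin (uniqueDiffOn_Ici 0) (by norm_num)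
    have h2 : Tendsto (derivWithin g (Ici 0)) (𝓝[>] 0) (𝓝 (derivWithin g (Ici 0) 0)) :=
      (h1 0 self_mem_Ici).mono_left (nhdsWithin_mono _ Ioi_subset_Ici_self)
    have h3 : Tendsto (fun r : ℝ => 1 * r ^ (N - 2 + 2 * ℓ + 1)) (𝓝[>] 0) (𝓝 0) :=
      tendsto_const_mul_pow_succ 1 _
    have := h3.mul h2
    rw [zero_mul] at this
    refine this.congr' ?_
    filter_upwards [self_mem_nhdsWithin] with x hx
    rw [derivWithin_of_mem_nhds (Ici_mem_nhds hx), one_mul]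
    congr 2; omega
  have hint : ∫⁻ r in Ioi (0 : ℝ), ‖F r‖ₑ ^ s * ENNReal.ofReal (r ^ (N - 1)) ≤ 1 := by
    have : (∫⁻ r in Ioi (0 : ℝ), ‖F r‖ₑ ^ s * ENNReal.ofReal (r ^ (N - 1))) ^ (1 / s) ≤ 1 := hE
    by_contra! hlt
    exact absurd this (not_le.2 (ENNReal.one_lt_rpow hlt (by positivity)))
  set σ : ℝ := N / s with hσ
  have hbound : ∀ t, 0 < t → |t ^ (N - 1 + 2 * ℓ) * deriv g t| ≤ t ^ ℓ * (2 * t ^ (N - σ)) := by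
    intro t ht
    -- The splitting height is `t^(-σ)` with `σ = N/s`: both terms of the split, integrated over
    -- `(0, t)`, are then bounded by `t^(N-σ)`.
    have hl : 0 < t ^ (-σ) := Real.rpow_pos_of_pos ht _
    have hcont : ContinuousOn (fun t => t ^ (N - 1 + ℓ) * F t) (Ioi 0) :=
      (continuousOn_id.pow _).mul hFc
    have h1 := enorm_le_lintegral_of_tendsto_zero ht hflux hcont hflux0
    have h2 : ∀ x ∈ Ioc 0 t, ‖x ^ (N - 1 + ℓ) * F x‖ₑ ≤
        ENNReal.ofReal (t ^ ℓ) * (ENNReal.ofReal (t ^ (-σ)) * ENNReal.ofReal (t ^ (N - 1))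
          + ENNReal.ofReal ((t ^ (-σ)) ^ (1 - s)) *
            (‖F x‖ₑ ^ s * ENNReal.ofReal (x ^ (N - 1)))) := by
      intro x hx
      have hx0 := hx.1
      have e1 : ‖x ^ (N - 1 + ℓ) * F x‖ₑ
          = ENNReal.ofReal (x ^ ℓ) * (ENNReal.ofReal (x ^ (N - 1)) * ‖F x‖ₑ) := by
        rw [enorm_mul, Real.enorm_of_nonneg (by positivity), pow_add,
          ENNReal.ofReal_mul (by positivity)]
        ring
      rw [e1]
      refine mul_le_mul' (ENNReal.ofReal_le_ofReal (pow_le_pow_left₀ hx0.le hx.2 _)) ?_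
      calc _ ≤ ENNReal.ofReal (x ^ (N - 1)) *
            (ENNReal.ofReal (t ^ (-σ)) + ENNReal.ofReal ((t ^ (-σ)) ^ (1 - s)) * ‖F x‖ₑ ^ s) :=
            mul_le_mul_right (enorm_le_add_rpow hs hl _) _
        _ = ENNReal.ofReal (t ^ (-σ)) * ENNReal.ofReal (x ^ (N - 1)) +
            ENNReal.ofReal ((t ^ (-σ)) ^ (1 - s)) *
            (‖F x‖ₑ ^ s * ENNReal.ofReal (x ^ (N - 1))) := by ring
        _ ≤ _ := by
            gcongr
            exact hx.2
    have h3 := h1.trans (setLIntegral_mono' measurableSet_Ioc h2)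
    rw [lintegral_const_mul' _ _ ENNReal.ofReal_ne_top, lintegral_add_left measurable_const,
      lintegral_const_mul' _ _ ENNReal.ofReal_ne_top, setLIntegral_const, Real.volume_Ioc,
      lintegral_const_mul' _ _ ENNReal.ofReal_ne_top] at h3
    have h4 : ∫⁻ x in Ioc 0 t, ‖F x‖ₑ ^ s * ENNReal.ofReal (x ^ (N - 1)) ≤ 1 :=
      (lintegral_mono_set Ioc_subset_Ioi_self).trans hint
    have h5 : ‖t ^ (N - 1 + 2 * ℓ) * deriv g t‖ₑ ≤ ENNReal.ofReal (t ^ ℓ * (2 * t ^ (N - σ))) := by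
      refine h3.trans ?_
      rw [ENNReal.ofReal_mul (by positivity)]
      gcongr
      rw [two_mul, ENNReal.ofReal_add (by positivity) (by positivity)]
      refine add_le_add ?_ ?_
      · rw [sub_zero, ← ENNReal.ofReal_mul (by positivity), ← ENNReal.ofReal_mul (by positivity)]
        refine ENNReal.ofReal_le_ofReal (le_of_eq ?_)
        rw [← pow_succ, Nat.sub_add_cancel (by omega), ← Real.rpow_natCast,
          ← Real.rpow_add ht]
        congr 1; ring
      · refine (mul_le_mul_right h4 _).trans ?_
        rw [mul_one, ← Real.rpow_mul ht.le]
        refine ENNReal.ofReal_le_ofReal (le_of_eq ?_)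
        congr 1
        rw [hσ]; field_simp; ring
    rw [Real.enorm_eq_ofReal_abs] at h5
    exact (ENNReal.ofReal_le_ofReal_iff (by positivity)).1 h5
  set κ : ℝ := σ + ℓ - 2 with hκ
  have hκ0 : 0 < κ := by
    have := ℓ.cast_nonneg (α := ℝ)
    linarith
  have hderiv : ∀ t, 0 < t → |deriv g t| ≤ 2 * t ^ (-κ - 1) := by
    intro t ht
    have h0 : 0 < t ^ (N - 1 + 2 * ℓ) := pow_pos ht _
    have := hbound t ht
    rw [abs_mul, abs_of_pos h0] at this
    refine le_of_mul_le_mul_left (this.trans_eq ?_) h0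
    rw [mul_left_comm, mul_left_comm _ (2 : ℝ), ← Real.rpow_natCast, ← Real.rpow_natCast,
      ← Real.rpow_add ht, ← Real.rpow_add ht]
    congr 2
    push_cast [Nat.cast_sub (show 1 ≤ N by omega)]
    rw [hκ]; ring
  have hpowd : ∀ t, 0 < t → HasDerivAt (fun t : ℝ => 2 / κ * t ^ (-κ)) (-(2 * t ^ (-κ - 1))) t := by
    intro t ht
    refine ((Real.hasDerivAt_rpow_const (Or.inl ht.ne')).const_mul (2 / κ)).congr_deriv ?_
    field_simp
  have hgr : |g r| ≤ 2 / κ * r ^ (-κ) := by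
    -- `T` lies beyond the support of `g`, so the derivative bound is integrated inwards from a
    -- point where `g` vanishes.
    set T := max (R + 1) (r + 1) with hT
    have hTr : r ≤ T := by linarith [le_max_right (R + 1) (r + 1)]
    have hT0 : 0 < T := hr.trans_le hTr
    have hgT : g T = 0 := hgR T (by linarith [le_max_left (R + 1) (r + 1)])
    have hpT : 0 ≤ 2 / κ * T ^ (-κ) := by positivity
    have hsub : ∀ x ∈ Icc r T, 0 < x := fun x hx => hr.trans_le hx.1
    have anti : ∀ c : ℝ, |c| = 1 → AntitoneOn (fun t => 2 / κ * t ^ (-κ) + c * g t) (Icc r T) := by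
      intro c hc
      have hd : ∀ x, 0 < x → HasDerivAt (fun t => 2 / κ * t ^ (-κ) + c * g t)
          (-(2 * x ^ (-κ - 1)) + c * deriv g x) x :=
        fun x hx => (hpowd x hx).add ((hg1 x hx).const_mul c)
      refine antitoneOn_of_deriv_nonpos (convex_Icc r T)
        (fun x hx => (hd x (hsub x hx)).continuousAt.continuousWithinAt)
        (fun x hx => (hd x (hsub x (interior_subset hx))).differentiableAt.differentiableWithinAt)
        (fun x hx => ?_)
      have hx := hsub x (interior_subset hx)
      rw [(hd x hx).deriv]
      have := le_abs_self (c * deriv g x)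
      rw [abs_mul, hc, one_mul] at this
      linarith [hderiv x hx]
    have a1 := anti 1 (by simp) ⟨le_rfl, hTr⟩ ⟨hTr, le_rfl⟩ hTr
    have a2 := anti (-1) (by simp) ⟨le_rfl, hTr⟩ ⟨hTr, le_rfl⟩ hTr
    simp only [hgT] at a1 a2
    exact abs_le.2 ⟨by linarith, by linarith⟩
  rw [abs_mul, abs_of_pos (pow_pos hr ℓ)]
  refine (mul_le_mul_of_nonneg_left hgr (pow_pos hr ℓ).le).trans_eq ?_
  rw [mul_left_comm, ← Real.rpow_natCast, ← Real.rpow_add hr]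
  congr 2
  rw [hκ]; ring

lemma le_of_ae_le_Ioi {f k : ℝ → ℝ} {R : ℝ} (hf : ContinuousOn f (Ioi R))
    (hk : ContinuousOn k (Ioi R)) (h : ∀ᵐ r ∂(volume.restrict (Ioi R)), f r ≤ k r) :
    ∀ r, R < r → f r ≤ k r := by
  have hopen : IsOpen (Ioi R ∩ (fun r => k r - f r) ⁻¹' Iio 0) :=
    (hk.sub hf).isOpen_inter_preimage isOpen_Ioi isOpen_Iio
  have hnull : volume (Ioi R ∩ (fun r => k r - f r) ⁻¹' Iio 0) = 0 := by
    rw [ae_restrict_iff' measurableSet_Ioi] at h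
    refine measure_mono_null (fun x hx => ?_) (ae_iff.1 h)
    intro hcon
    have h1 := hcon hx.1
    have h2 : k x - f x < 0 := hx.2
    linarith
  rw [hopen.measure_eq_zero_iff volume] at hnull
  intro r hr
  by_contra! hlt
  have : r ∈ Ioi R ∩ (fun r => k r - f r) ⁻¹' Iio 0 := ⟨hr, by simpa using hlt⟩
  rw [hnull] at this
  exact this

/-- Decay at infinity of continuous functions in the energy space. -/
lemma MemEnergySpace.eventually_abs_le {N ℓ : ℕ} {s : ℝ} (hN : 2 ≤ N) (hs : 1 < s)
    (hsN : 2 < N / s) {f : ℝ → ℝ} (hf : MemEnergySpace N ℓ s f) (hfc : ContinuousOn f (Ioi 0)) :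
    ∃ C, ∀ᶠ r in atTop, |f r| ≤ C * r ^ (2 - N / s) := by
  obtain ⟨g, hg, hcauchy, hae⟩ := hf
  have hev := hcauchy.eventually_le_const (u := 1) (by norm_num)
  obtain ⟨⟨n₁, n₂⟩, hn⟩ := eventually_atTop.1 hev
  -- No smallness beyond norm at most `1` is needed: outside the support of `g n` the difference `g
  -- k - g n` equals `g k`, so the pointwise bound passes to the almost everywhere limit.
  set n := max n₁ n₂ with hndef
  have hn' : ∀ k, n ≤ k → energyNorm N ℓ s (fun r => r ^ ℓ * g k r - r ^ ℓ * g n r) ≤ 1 :=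
    fun k hk => hn (k, n) ⟨(le_max_left _ _).trans hk, le_max_right _ _⟩
  obtain ⟨hgn, R, hR⟩ := hg n
  set R' := max R 0 with hR'
  refine ⟨2 / (N / s + ℓ - 2), ?_⟩
  filter_upwards [eventually_gt_atTop R'] with r hr
  have hpos : ∀ x, R' < x → 0 < x := fun x hx => (le_max_right R 0).trans_lt hx
  refine le_of_ae_le_Ioi (f := fun r => |f r|) (R := R')
    (k := fun r => 2 / (N / s + ℓ - 2) * r ^ (2 - N / s))
    (hfc.mono fun x hx => hpos x hx).abs ?_ ?_ r hr
  · exact continuousOn_const.mul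
      (continuousOn_id.rpow_const fun x hx => Or.inl (hpos x hx).ne')
  · have hae' := ae_restrict_of_ae_restrict_of_subset (Ioi_subset_Ioi (le_max_right R 0)) hae
    filter_upwards [hae', ae_restrict_mem measurableSet_Ioi] with x hx hxR
    refine le_of_tendsto hx.abs ?_
    filter_upwards [eventually_ge_atTop n] with k hk
    have hx0 := hpos x hxR
    have hd : IsC2cHalfLine (fun r => g k r - g n r) := by
      obtain ⟨hgk, Rk, hRk⟩ := hg k
      refine ⟨hgk.sub hgn, max Rk R, fun y hy => ?_⟩
      change g k y - g n y = 0
      rw [hRk y ((le_max_left _ _).trans_lt hy), hR y ((le_max_right _ _).trans_lt hy), sub_zero]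
    have := abs_le_of_energyNorm_le_one (ℓ := ℓ) hN hs hsN hd
      (by simpa only [mul_sub] using hn' k hk) hx0
    rwa [hR x ((le_max_left R 0).trans_lt hxR), sub_zero] at this


/-! ### Arithmetic of the critical hyperbola. -/

section Exponents

variable {N : ℕ} {p q : ℝ}

/-- The decay rate `2 - N/s` becomes `-N/(q+1)`, so that `u^(q+1)` is `O(r^(-N))`. -/
lemma two_sub_div_exponent (hN : 3 ≤ N) (hp : 0 < p) (hq : 0 < q)
    (hpq : 1 / (p + 1) + 1 / (q + 1) = ((N : ℝ) - 2) / (N : ℝ)) :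
    2 - (N : ℝ) / ((p + 1) / p) = -((N : ℝ) / (q + 1)) := by
  have hN0 : (0 : ℝ) < N := by exact_mod_cast (by omega : 0 < N)
  have h1 : (0 : ℝ) < p + 1 := by linarith
  have h2 : (0 : ℝ) < q + 1 := by linarith
  field_simp at hpq ⊢
  linarith

lemma one_lt_exponent (hp : 0 < p) : 1 < (p + 1) / p := by
  rw [lt_div_iff₀ hp]; linarith

lemma two_lt_div_exponent (hN : 3 ≤ N) (hp : 0 < p) (hq : 0 < q)
    (hpq : 1 / (p + 1) + 1 / (q + 1) = ((N : ℝ) - 2) / (N : ℝ)) :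
    2 < (N : ℝ) / ((p + 1) / p) := by
  have hN0 : (0 : ℝ) < N := by exact_mod_cast (by omega : 0 < N)
  have := two_sub_div_exponent hN hp hq hpq
  have h2 : 0 < (N : ℝ) / (q + 1) := by positivity
  linarith

lemma one_lt_mul_of_critical (hN : 3 ≤ N) (hp : 0 < p) (hq : 0 < q)
    (hpq : 1 / (p + 1) + 1 / (q + 1) = ((N : ℝ) - 2) / (N : ℝ)) : 1 < p * q := by
  have hN0 : (0 : ℝ) < N := by exact_mod_cast (by omega : 0 < N)
  have h1 : (0 : ℝ) < p + 1 := by linarith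
  have h2 : (0 : ℝ) < q + 1 := by linarith
  have h3 : ((N : ℝ) - 2) / N < 1 := by rw [div_lt_one hN0]; linarith
  rw [← hpq, div_add_div _ _ h1.ne' h2.ne', div_lt_one (by positivity)] at h3
  linarith

/-- Decay at infinity of continuous functions in `𝓔_ℓ^((p+1)/p)`. -/
lemma MemEnergySpace.decay (hN : 3 ≤ N) (hp : 0 < p) (hq : 0 < q)
    (hpq : 1 / (p + 1) + 1 / (q + 1) = ((N : ℝ) - 2) / (N : ℝ)) {ℓ : ℕ} {f : ℝ → ℝ}
    (hf : MemEnergySpace N ℓ ((p + 1) / p) f) (hfc : ContinuousOn f (Ioi 0)) :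
    ∃ C, ∀ᶠ r in atTop, |f r| ≤ C * r ^ (-((N : ℝ) / (q + 1))) := by
  rw [← two_sub_div_exponent hN hp hq hpq]
  exact hf.eventually_abs_le (by omega) (one_lt_exponent hp)
    (two_lt_div_exponent hN hp hq hpq) hfc

end Exponents

lemma tendsto_zero_of_decay {f : ℝ → ℝ} {C κ : ℝ} (hκ : 0 < κ)
    (h : ∀ᶠ r in atTop, |f r| ≤ C * r ^ (-κ)) : Tendsto f atTop (𝓝 0) := by
  refine squeeze_zero_norm' h ?_
  simpa using (tendsto_rpow_neg_atTop hκ).const_mul C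

/-! ### Regular profiles and the generators of translations and dilations. -/

/-- A regular radial function on `ℝ^N` with `-Δ u = w`. -/
structure IsRegularProfile (N : ℕ) (u w : ℝ → ℝ) : Prop where
  contDiffOn : ContDiffOn ℝ 2 u (Ici 0)
  deriv_zero : derivWithin u (Ici 0) 0 = 0
  eq : ∀ r, 0 < r → - deriv (deriv u) r - ((N : ℝ) - 1) / r * deriv u r = w r

namespace IsRegularProfile

variable {N : ℕ} {u w : ℝ → ℝ}

lemma contDiffOn_Ioi (H : IsRegularProfile N u w) : ContDiffOn ℝ 2 u (Ioi 0) :=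
  H.contDiffOn.mono Ioi_subset_Ici_self

lemma hasDerivAt (H : IsRegularProfile N u w) {r : ℝ} (hr : 0 < r) :
    HasDerivAt u (deriv u r) r :=
  (contDiffOn_two_Ioi H.contDiffOn_Ioi).1 r hr

lemma hasDerivAt_deriv (H : IsRegularProfile N u w) {r : ℝ} (hr : 0 < r) :
    HasDerivAt (deriv u) (-((N : ℝ) - 1) / r * deriv u r - w r) r := by
  refine ((contDiffOn_two_Ioi H.contDiffOn_Ioi).2.1 r hr).congr_deriv ?_
  rw [← H.eq r hr]
  ring

lemma tendsto_zero (H : IsRegularProfile N u w) : Tendsto u (𝓝[>] 0) (𝓝 (u 0)) :=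
  (H.contDiffOn.continuousOn 0 self_mem_Ici).mono_left (nhdsWithin_mono _ Ioi_subset_Ici_self)

lemma tendsto_deriv_zero (H : IsRegularProfile N u w) : Tendsto (deriv u) (𝓝[>] 0) (𝓝 0) := by
  have h1 : ContinuousOn (derivWithin u (Ici 0)) (Ici 0) :=
    H.contDiffOn.continuousOn_derivWithin (uniqueDiffOn_Ici 0) (by norm_num)
  have h2 : Tendsto (derivWithin u (Ici 0)) (𝓝[>] 0) (𝓝 (derivWithin u (Ici 0) 0)) :=
    (h1 0 self_mem_Ici).mono_left (nhdsWithin_mono _ Ioi_subset_Ici_self)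
  rw [H.deriv_zero] at h2
  refine h2.congr' ?_
  filter_upwards [self_mem_nhdsWithin] with x hx
  rw [derivWithin_of_mem_nhds (Ici_mem_nhds hx)]

lemma hasDerivAt_flux (H : IsRegularProfile N u w) (hN : 1 ≤ N) {r : ℝ} (hr : 0 < r) :
    HasDerivAt (fun r => r ^ (N - 1) * deriv u r) (-(r ^ (N - 1) * w r)) r := by
  have h := hasDerivAt_flux_div_pow (N := N) (ℓ := 0) hN H.contDiffOn_Ioi hr
  simp only [mul_zero, add_zero, pow_zero, div_one] at h
  refine h.congr_deriv ?_
  rw [← H.eq r hr, radialLaplacian]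
  simp only [CharP.cast_eq_zero]
  ring

lemma tendsto_pow_mul_zero (k : ℕ) {f : ℝ → ℝ} {c : ℝ} (hf : Tendsto f (𝓝[>] 0) (𝓝 c)) :
    Tendsto (fun r => r ^ (k + 1) * f r) (𝓝[>] 0) (𝓝 0) := by
  simpa using (tendsto_const_mul_pow_succ 1 k).mul hf

lemma radialPoisson (H : IsRegularProfile N u w) (hN : 2 ≤ N) :
    RadialPoisson (N - 1) u (deriv u) w where
  hasDerivAt r hr := H.hasDerivAt hr
  hasDerivAt_flux r hr := H.hasDerivAt_flux (by omega) hr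
  flux_zero := by
    have := tendsto_pow_mul_zero (N - 2) H.tendsto_deriv_zero
    rwa [show N - 2 + 1 = N - 1 by omega] at this

lemma deriv_neg (H : IsRegularProfile N u w) (hN : 2 ≤ N) (hw : ∀ r, 0 < r → 0 < w r) {r : ℝ}
    (hr : 0 < r) : deriv u r < 0 :=
  (H.radialPoisson hN).deriv_neg_of_pos (R := r + 1) (fun x hx => hw x hx.1) r ⟨hr, by linarith⟩

/-- L'Hôpital's rule for flux over `r^N`. A nonzero `w₀` makes the translation mode `u'/r` nonzero
at the origin. -/
lemma tendsto_deriv_div (H : IsRegularProfile N u w) (hN : 2 ≤ N) {w₀ : ℝ}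
    (hw : Tendsto w (𝓝[>] 0) (𝓝 w₀)) :
    Tendsto (fun r => deriv u r / r) (𝓝[>] 0) (𝓝 (-w₀ / N)) := by
  have hN0 : (N : ℝ) ≠ 0 := by exact_mod_cast (by omega : N ≠ 0)
  have h : Tendsto (fun r => (r ^ (N - 1) * deriv u r) / r ^ N) (𝓝[>] 0) (𝓝 (-w₀ / N)) := by
    refine HasDerivAt.lhopital_zero_nhdsGT (f' := fun r => -(r ^ (N - 1) * w r))
      (g' := fun r => N * r ^ (N - 1)) ?_ ?_ ?_ (H.radialPoisson hN).flux_zero ?_ ?_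
    · filter_upwards [self_mem_nhdsWithin] with r hr using H.hasDerivAt_flux (by omega) hr
    · exact .of_forall fun r => hasDerivAt_pow N r
    · filter_upwards [self_mem_nhdsWithin] with r hr
      exact mul_ne_zero hN0 (pow_ne_zero _ (ne_of_gt hr))
    · have := tendsto_const_mul_pow_succ 1 (N - 1)
      simpa [show N - 1 + 1 = N by omega] using this
    · refine (hw.neg.div_const (N : ℝ)).congr' ?_
      filter_upwards [self_mem_nhdsWithin] with r hr
      have : r ^ (N - 1) ≠ 0 := pow_ne_zero _ (ne_of_gt hr)
      field_simp
  refine h.congr' ?_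
  filter_upwards [self_mem_nhdsWithin] with r hr
  have hr : 0 < r := hr
  obtain ⟨n, rfl⟩ : ∃ n, N = n + 1 := ⟨N - 1, by omega⟩
  rw [Nat.add_sub_cancel, pow_succ]
  field_simp

/-- The generator of translations solves the linearized equation in the sector `ℓ = 1`. -/
lemma radialPoisson_deriv_div (H : IsRegularProfile N u w) (hN : 2 ≤ N) {w' : ℝ → ℝ} {w₀ : ℝ}
    (hw : Tendsto w (𝓝[>] 0) (𝓝 w₀)) (hw' : ∀ r, 0 < r → HasDerivAt w (w' r) r) :
    RadialPoisson (N + 1) (fun r => deriv u r / r)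
      (fun r => -N * deriv u r / r ^ 2 - w r / r) (fun r => w' r / r) where
  hasDerivAt r hr := by
    have hr' := hr.ne'
    refine ((H.hasDerivAt_deriv hr).fun_div (hasDerivAt_id' r) hr').congr_deriv ?_
    field_simp
    ring
  hasDerivAt_flux r hr := by
    -- The flux is `r^(N+1) (u'/r)' = -N r^(N-1) u' - r^N w`, which involves no second derivative of
    -- `u`.
    have hd := ((H.hasDerivAt_flux (by omega) hr).const_mul (-(N : ℝ))).fun_sub
      ((hasDerivAt_pow N r).fun_mul (hw' r hr))
    refine (hd.congr_deriv ?_).congr_of_eventuallyEq ?_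
    · field_simp
      ring
    · filter_upwards [Ioi_mem_nhds hr] with x hx
      have hx : 0 < x := hx
      obtain ⟨n, rfl⟩ : ∃ n, N = n + 1 := ⟨N - 1, by omega⟩
      rw [Nat.add_sub_cancel]
      field_simp
      ring
  flux_zero := by
    have h1 := ((H.radialPoisson hN).flux_zero.const_mul (-(N : ℝ))).sub
      (tendsto_pow_mul_zero (N - 1) hw)
    rw [mul_zero, sub_zero] at h1
    refine h1.congr' ?_
    filter_upwards [self_mem_nhdsWithin] with x hx
    have hx : 0 < x := hx
    obtain ⟨n, rfl⟩ : ∃ n, N = n + 1 := ⟨N - 1, by omega⟩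
    rw [Nat.add_sub_cancel]
    field_simp
    ring

/-- The generator of dilations solves the linearized equation in the sector `ℓ = 0`. -/
lemma radialPoisson_dilation (H : IsRegularProfile N u w) (hN : 2 ≤ N) {w' : ℝ → ℝ} {w₀ : ℝ}
    (hw : Tendsto w (𝓝[>] 0) (𝓝 w₀)) (hw' : ∀ r, 0 < r → HasDerivAt w (w' r) r) (α : ℝ) :
    RadialPoisson (N - 1) (fun r => r * deriv u r + α * u r)
      (fun r => (2 - N + α) * deriv u r - r * w r) (fun r => (2 + α) * w r + r * w' r) where
  hasDerivAt r hr := by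
    have hr' := hr.ne'
    refine (((hasDerivAt_id' r).fun_mul (H.hasDerivAt_deriv hr)).fun_add
      ((H.hasDerivAt hr).const_mul α)).congr_deriv ?_
    field_simp
    ring
  hasDerivAt_flux r hr := by
    have hd := ((H.hasDerivAt_flux (by omega) hr).const_mul (2 - N + α)).fun_sub
      ((hasDerivAt_pow N r).fun_mul (hw' r hr))
    obtain ⟨n, rfl⟩ : ∃ n, N = n + 1 := ⟨N - 1, by omega⟩
    rw [Nat.add_sub_cancel] at hd ⊢
    refine (hd.congr_deriv ?_).congr_of_eventuallyEq (.of_forall fun x => ?_)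
    · push_cast; ring
    · simp only; ring
  flux_zero := by
    have h1 := ((H.radialPoisson hN).flux_zero.const_mul (2 - N + α)).sub
      (tendsto_pow_mul_zero (N - 1) hw)
    rw [mul_zero, sub_zero] at h1
    refine h1.congr fun x => ?_
    obtain ⟨n, rfl⟩ : ∃ n, N = n + 1 := ⟨N - 1, by omega⟩
    rw [Nat.add_sub_cancel]
    ring

/-- A positive superharmonic radial function decays at most like the fundamental solution. -/
lemma neg_mul_deriv_le (H : IsRegularProfile N u w) (hN : 3 ≤ N) (hw : ∀ r, 0 < r → 0 < w r)
    (hu : ∀ r, 0 < r → 0 < u r) {r : ℝ} (hr : 0 < r) :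
    -(r * deriv u r) ≤ (N - 2) * u r := by
  by_contra! hlt
  -- `z` is decreasing since `z' = -r w`, and `(r^(N-2) u)' = r^(N-3) z`. Once `z` is negative,
  -- `r^(N-2) u` falls at least linearly and must become nonpositive.
  set z : ℝ → ℝ := fun r => r * deriv u r + (N - 2) * u r with hz
  have hzd : ∀ x, 0 < x → HasDerivAt z (-(x * w x)) x := by
    intro x hx
    have hx' := hx.ne'
    refine (((hasDerivAt_id' x).fun_mul (H.hasDerivAt_deriv hx)).fun_add
      ((H.hasDerivAt hx).const_mul ((N : ℝ) - 2))).congr_deriv ?_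
    field_simp
    ring
  have hanti : AntitoneOn z (Ioi 0) := by
    refine antitoneOn_of_deriv_nonpos (convex_Ioi 0)
      (fun x hx => (hzd x hx).continuousAt.continuousWithinAt)
      (fun x hx => (hzd x (interior_subset hx)).differentiableAt.differentiableWithinAt)
      (fun x hx => ?_)
    rw [(hzd x (interior_subset hx)).deriv]
    have hx0 : 0 < x := interior_subset hx
    have := mul_pos hx0 (hw x hx0)
    linarith
  have hzr : z r < 0 := by simp only [hz]; linarith
  set δ := -z r with hδ
  have hδ0 : 0 < δ := by linarith
  obtain ⟨n, rfl⟩ : ∃ n, N = n + 3 := ⟨N - 3, by omega⟩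
  set T := max r 1 with hT
  have hT1 : 1 ≤ T := le_max_right _ _
  have hT0 : 0 < T := by linarith
  have hyd : ∀ x, 0 < x → HasDerivAt (fun x => x ^ (n + 1) * u x + δ * x) (x ^ n * z x + δ) x := by
    intro x hx
    refine (((hasDerivAt_pow (n + 1) x).fun_mul (H.hasDerivAt hx)).fun_add
      ((hasDerivAt_id' x).const_mul δ)).congr_deriv ?_
    simp only [hz, Nat.add_sub_cancel]
    push_cast
    ring
  have hanti2 : AntitoneOn (fun x => x ^ (n + 1) * u x + δ * x) (Ici T) := by
    refine antitoneOn_of_deriv_nonpos (convex_Ici T)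
      (fun x hx => (hyd x (hT0.trans_le hx)).continuousAt.continuousWithinAt)
      (fun x hx => (hyd x (hT0.trans_le
        (interior_subset hx))).differentiableAt.differentiableWithinAt)
      (fun x hx => ?_)
    have hxT : T ≤ x := interior_subset hx
    have hx0 : 0 < x := hT0.trans_le hxT
    rw [(hyd x hx0).deriv]
    have h1 : z x ≤ -δ := by
      have := hanti (mem_Ioi.2 hr) (mem_Ioi.2 hx0) ((le_max_left r 1).trans hxT)
      linarith
    have h2 : 1 ≤ x ^ n := one_le_pow₀ (hT1.trans hxT)
    nlinarith
  set y := T ^ (n + 1) * u T with hy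
  have hy0 : 0 < y := mul_pos (pow_pos hT0 _) (hu T hT0)
  -- At slope at most `-δ` the value `y` at `T` is used up by the point `T + y/δ`.
  have hX : T ≤ T + y / δ := by
    have : 0 < y / δ := by positivity
    linarith
  have h3 := hanti2 self_mem_Ici (mem_Ici.2 hX) hX
  have h4 : 0 < (T + y / δ) ^ (n + 1) * u (T + y / δ) :=
    mul_pos (pow_pos (hT0.trans_le hX) _) (hu _ (hT0.trans_le hX))
  have h5 : δ * (T + y / δ) = δ * T + y := by field_simp
  simp only [h5] at h3
  linarith

end IsRegularProfile

/-! ### The linearized system and proportionality of its decaying solutions. -/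

lemma IsLinearizedSolution.radialPoisson_fst {N ℓ : ℕ} {p q : ℝ} {u v ψ φ : ℝ → ℝ} (hN : 2 ≤ N)
    (H : IsLinearizedSolution N ℓ p q u v ψ φ) (h0 : RegularAtOrigin ℓ ψ) :
    RadialPoisson (N - 1 + 2 * ℓ) (fun r => ψ r / r ^ ℓ) (deriv fun r => ψ r / r ^ ℓ)
      (fun r => p * v r ^ (p - 1) * (φ r / r ^ ℓ)) where
  hasDerivAt r hr :=
    (((contDiffOn_two_Ioi H.contDiffOn_fst).1 r hr).differentiableAt.fun_div
      (differentiableAt_pow ℓ) (pow_ne_zero ℓ hr.ne')).hasDerivAt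
  hasDerivAt_flux r hr := by
    refine (hasDerivAt_flux_div_pow (by omega) H.contDiffOn_fst hr).congr_deriv ?_
    have e : radialLaplacian N ℓ ψ r = -(p * v r ^ (p - 1) * φ r) := by
      rw [← H.eq_fst r hr, radialLaplacian]; ring
    rw [e, show N - 1 + 2 * ℓ = N - 1 + ℓ + ℓ by ring, pow_add _ (N - 1 + ℓ) ℓ]
    field_simp
  flux_zero := by
    have := IsRegularProfile.tendsto_pow_mul_zero (N - 2 + 2 * ℓ) h0.2
    rwa [show N - 2 + 2 * ℓ + 1 = N - 1 + 2 * ℓ by omega] at this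

lemma IsLinearizedSolution.symm {N ℓ : ℕ} {p q : ℝ} {u v ψ φ : ℝ → ℝ}
    (H : IsLinearizedSolution N ℓ p q u v ψ φ) : IsLinearizedSolution N ℓ q p v u φ ψ :=
  ⟨H.contDiffOn_snd, H.contDiffOn_fst, H.eq_snd, H.eq_fst⟩

/-- Two regular solutions of a cooperative linear system decaying at infinity are proportional. -/
lemma exists_eq_const_mul {m ℓ : ℕ} {a b f g f' g' f₁ g₁ f₁' g₁' : ℝ → ℝ}
    {a₀ b₀ f₀ g₀ f₁₀ g₁₀ : ℝ}
    (ha : ∀ r, 0 < r → 0 < a r) (hb : ∀ r, 0 < r → 0 < b r)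
    (hac : ContinuousOn a (Ioi 0)) (hbc : ContinuousOn b (Ioi 0))
    (ha0 : Tendsto a (𝓝[>] 0) (𝓝 a₀)) (hb0 : Tendsto b (𝓝[>] 0) (𝓝 b₀))
    (Hf : RadialPoisson m f f' (fun r => a r * g r))
    (Hg : RadialPoisson m g g' (fun r => b r * f r))
    (Hf₁ : RadialPoisson m f₁ f₁' (fun r => a r * g₁ r))
    (Hg₁ : RadialPoisson m g₁ g₁' (fun r => b r * f₁ r))
    (hf0 : Tendsto f (𝓝[>] 0) (𝓝 f₀)) (hg0 : Tendsto g (𝓝[>] 0) (𝓝 g₀))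
    (hf₁0 : Tendsto f₁ (𝓝[>] 0) (𝓝 f₁₀)) (hg₁0 : Tendsto g₁ (𝓝[>] 0) (𝓝 g₁₀))
    (hne : f₁₀ ≠ 0)
    (hfi : Tendsto (fun r => r ^ ℓ * f r) atTop (𝓝 0))
    (hf₁i : Tendsto (fun r => r ^ ℓ * f₁ r) atTop (𝓝 0)) :
    ∃ c, ∀ r, 0 < r → f r = c * f₁ r ∧ g r = c * g₁ r := by
  -- This multiple makes `f - c f₁` vanish at the origin; the three signs of the limit of `g - c g₁`
  -- there are then treated separately.
  set c := f₀ / f₁₀ with hc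
  have HF := (Hf.sub_smul Hf₁ c).congr_right (k := fun r => a r * (g r - c * g₁ r))
    fun r _ => by ring
  have HG := (Hg.sub_smul Hg₁ c).congr_right (k := fun r => b r * (f r - c * f₁ r))
    fun r _ => by ring
  have hF0 : Tendsto (fun r => f r - c * f₁ r) (𝓝[>] 0) (𝓝 0) := by
    have := hf0.sub (hf₁0.const_mul c)
    rwa [hc, div_mul_cancel₀ _ hne, sub_self] at this
  have hG0 := hg0.sub (hg₁0.const_mul c)
  have hFi : Tendsto (fun r => r ^ ℓ * (f r - c * f₁ r)) atTop (𝓝 0) := by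
    have := hfi.sub (hf₁i.const_mul c)
    rw [mul_zero, sub_zero] at this
    exact this.congr fun r => by ring
  refine ⟨c, fun r hr => ?_⟩
  rcases lt_trichotomy (g₀ - c * g₁₀) 0 with h | h | h
  · exact absurd hFi (not_tendsto_zero_of_start ha hb HF HG hF0 hG0 h)
  · rw [h] at hG0
    obtain ⟨h1, h2⟩ := eq_zero_of_start hac hbc ha0 hb0 HF HG hF0 hG0 r hr
    exact ⟨by linarith, by linarith⟩
  · refine absurd ?_ (not_tendsto_zero_of_start (ℓ := ℓ) ha hb
      (HF.neg.congr_right (k := fun r => a r * -(g r - c * g₁ r)) fun r _ => by ring)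
      (HG.neg.congr_right (k := fun r => b r * -(f r - c * f₁ r)) fun r _ => by ring)
      (by simpa using hF0.neg) hG0.neg (by linarith))
    have := hFi.neg
    rw [neg_zero] at this
    exact this.congr fun r => by ring


/-! ### Moments and comparison of Newtonian potentials across dimensions. -/

/-- The moment `∫_0^t r^j |x(r)| dr`. -/
noncomputable def moment (j : ℕ) (x : ℝ → ℝ) (t : ℝ) : ℝ≥0∞ :=
  ∫⁻ r in Ioo 0 t, ‖r ^ j * x r‖ₑ

lemma moment_mono (j : ℕ) (x : ℝ → ℝ) : Monotone (moment j x) :=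
  fun _ _ h => lintegral_mono_set (Ioo_subset_Ioo_right h)

lemma enorm_pow_add_mul {j k : ℕ} {r y : ℝ} (hr : 0 < r) :
    ‖r ^ (j + k) * y‖ₑ = ENNReal.ofReal (r ^ k) * ‖r ^ j * y‖ₑ := by
  rw [pow_add, mul_comm (r ^ j), mul_assoc, enorm_mul, Real.enorm_of_nonneg (pow_pos hr k).le]

lemma moment_add_le (j k : ℕ) (x : ℝ → ℝ) (t : ℝ) :
    moment (j + k) x t ≤ ENNReal.ofReal (t ^ k) * moment j x t := by
  rw [moment, moment, ← lintegral_const_mul' _ _ ENNReal.ofReal_ne_top]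
  refine setLIntegral_mono' measurableSet_Ioo fun r hr => ?_
  rw [enorm_pow_add_mul hr.1]
  exact mul_le_mul_left (ENNReal.ofReal_le_ofReal (pow_le_pow_left₀ hr.1.le hr.2.le k)) _

lemma aemeasurable_enorm_pow_mul {x : ℝ → ℝ} (hx : ContinuousOn x (Ioi 0)) (j : ℕ) :
    AEMeasurable (fun r => ‖r ^ j * x r‖ₑ) (volume.restrict (Ioi 0)) :=
  (((continuousOn_id.pow j).mul hx).aemeasurable measurableSet_Ioi).enorm

lemma moment_add_lt {j k : ℕ} (hk : k ≠ 0) {x : ℝ → ℝ} {t : ℝ} (ht : 0 < t)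
    (hx : ContinuousOn x (Ioi 0)) (hx0 : ∀ r, 0 < r → x r ≠ 0) (hfin : moment j x t ≠ ∞) :
    moment (j + k) x t < ENNReal.ofReal (t ^ k) * moment j x t := by
  have hfin' : moment (j + k) x t ≠ ∞ :=
    ne_top_of_le_ne_top (ENNReal.mul_ne_top ENNReal.ofReal_ne_top hfin) (moment_add_le j k x t)
  rw [moment, moment, ← lintegral_const_mul' _ _ ENNReal.ofReal_ne_top]
  refine lintegral_strict_mono ?_ ?_ hfin' ?_
  · rw [Ne, Measure.restrict_eq_zero, Real.volume_Ioo]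
    simpa using ht
  · exact ((aemeasurable_enorm_pow_mul hx j).mono_measure
      (Measure.restrict_mono Ioo_subset_Ioi_self le_rfl)).const_mul _
  · filter_upwards [ae_restrict_mem measurableSet_Ioo] with r hr
    rw [enorm_pow_add_mul hr.1]
    refine ENNReal.mul_lt_mul_left ?_ enorm_ne_top ?_
    · rw [Ne, enorm_eq_zero]
      exact mul_ne_zero (pow_pos hr.1 j).ne' (hx0 r hr.1)
    · exact (ENNReal.ofReal_lt_ofReal_iff (pow_pos ht k)).2 (pow_lt_pow_left₀ hr.2 hr.1.le hk)

/-- Tonelli on the triangle `0 < r < t`. It rewrites the pairing of a density with a Newtonian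
potential as an integral of a product of two moments. -/
lemma lintegral_mul_lintegral_Ioi_swap {P K : ℝ → ℝ≥0∞}
    (hP : AEMeasurable P (volume.restrict (Ioi 0))) (hK : AEMeasurable K (volume.restrict (Ioi 0))) :
    ∫⁻ r in Ioi 0, P r * ∫⁻ t in Ioi r, K t = ∫⁻ t in Ioi 0, (∫⁻ r in Ioo 0 t, P r) * K t := by
  set W : ℝ → ℝ → ℝ≥0∞ := fun r t => {z : ℝ × ℝ | z.1 < z.2}.indicator
    (fun z => P z.1 * K z.2) (r, t) with hW
  have hWm : AEMeasurable (Function.uncurry W)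
      ((volume.restrict (Ioi (0 : ℝ))).prod (volume.restrict (Ioi (0 : ℝ)))) :=
    (hP.comp_fst.mul hK.comp_snd).indicator (measurableSet_lt measurable_fst measurable_snd)
  calc _ = ∫⁻ r in Ioi 0, ∫⁻ t in Ioi 0, W r t := by
        refine setLIntegral_congr_fun measurableSet_Ioi fun r hr => ?_
        have hr : 0 < r := hr
        have e : ∀ t, W r t = (Ioi r).indicator (fun t => P r * K t) t := fun t => by
          simp only [hW, indicator_apply, mem_ofPred_eq, mem_Ioi]
        simp only [e]
        rw [setLIntegral_indicator measurableSet_Ioi,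
          inter_eq_left.2 (Ioi_subset_Ioi hr.le), lintegral_const_mul'']
        exact hK.mono_measure (Measure.restrict_mono (Ioi_subset_Ioi hr.le) le_rfl)
    _ = ∫⁻ t in Ioi 0, ∫⁻ r in Ioi 0, W r t := lintegral_lintegral_swap hWm
    _ = _ := by
        refine setLIntegral_congr_fun measurableSet_Ioi fun t ht => ?_
        have e : ∀ r, W r t = (Iio t).indicator (fun r => P r * K t) r := fun r => by
          simp only [hW, indicator_apply, mem_ofPred_eq, mem_Iio]
        simp only [e]
        rw [setLIntegral_indicator measurableSet_Iio, Iio_inter_Ioi, lintegral_mul_const'']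
        exact hP.mono_measure (Measure.restrict_mono Ioo_subset_Ioi_self le_rfl)

lemma RadialPoisson.continuousOn_deriv {m : ℕ} {f f' h : ℝ → ℝ} (H : RadialPoisson m f f' h) :
    ContinuousOn f' (Ioi 0) := by
  have h1 : ContinuousOn (fun r => r ^ m * f' r) (Ioi 0) :=
    fun r hr => (H.hasDerivAt_flux r hr).continuousAt.continuousWithinAt
  refine (h1.div (continuousOn_id.pow m) fun r hr => pow_ne_zero m (ne_of_gt hr)).congr
    fun r hr => ?_
  have : r ^ m ≠ 0 := pow_ne_zero m (ne_of_gt hr)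
  simp [this]

lemma inv_ofReal_mul_enorm {c y : ℝ} (hc : 0 < c) :
    (ENNReal.ofReal c)⁻¹ * ‖c * y‖ₑ = ‖y‖ₑ := by
  rw [enorm_mul, Real.enorm_of_nonneg hc.le, ← mul_assoc,
    ENNReal.inv_mul_cancel (by simpa using hc) ENNReal.ofReal_ne_top, one_mul]

/-- Upper bound for a decaying solution through the Newtonian potential of its source. -/
lemma RadialPoisson.enorm_le {m : ℕ} {f f' h : ℝ → ℝ} (H : RadialPoisson m f f' h)
    (hh : ContinuousOn h (Ioi 0)) (hf : Tendsto f atTop (𝓝 0)) {r : ℝ} (hr : 0 < r) :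
    ‖f r‖ₑ ≤ ∫⁻ t in Ioi r, (ENNReal.ofReal (t ^ m))⁻¹ * moment m h t := by
  have h1 : ∀ t, 0 < t → ‖f' t‖ₑ ≤ (ENNReal.ofReal (t ^ m))⁻¹ * moment m h t := by
    intro t ht
    have := enorm_le_lintegral_of_tendsto_zero ht H.hasDerivAt_flux
      ((continuousOn_id.pow m).mul hh).neg H.flux_zero
    simp only [enorm_neg] at this
    rw [← setLIntegral_congr Ioo_ae_eq_Ioc] at this
    rw [← inv_ofReal_mul_enorm (y := f' t) (pow_pos ht m)]
    exact mul_le_mul_right this _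
  have hlim : Tendsto (fun R => ‖f R - f r‖ₑ) atTop (𝓝 ‖f r‖ₑ) := by
    have := (hf.sub (tendsto_const_nhds (x := f r))).enorm
    rwa [zero_sub, enorm_neg] at this
  refine le_of_tendsto hlim ?_
  filter_upwards [eventually_ge_atTop r] with R hR
  calc _ ≤ ∫⁻ t in Ioc r R, ‖f' t‖ₑ :=
        enorm_sub_le_lintegral hr hR H.hasDerivAt H.continuousOn_deriv
    _ ≤ ∫⁻ t in Ioi r, ‖f' t‖ₑ := lintegral_mono_set Ioc_subset_Ioi_self
    _ ≤ _ := setLIntegral_mono' measurableSet_Ioi fun t ht => h1 t (hr.trans ht)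

lemma lintegral_eq_ofReal_sub {F F' : ℝ → ℝ} {a b : ℝ} (ha : 0 < a) (hab : a ≤ b)
    (hF : ∀ r, 0 < r → HasDerivAt F (F' r) r) (hc : ContinuousOn F' (Ioi 0))
    (hpos : ∀ r, 0 < r → 0 ≤ F' r) :
    ∫⁻ x in Ioc a b, ‖F' x‖ₑ = ENNReal.ofReal (F b - F a) := by
  have hc' : ContinuousOn F' (uIcc a b) := by
    rw [uIcc_of_le hab]; exact hc.mono fun x hx => ha.trans_le hx.1
  rw [← intervalIntegral.integral_eq_sub_of_hasDerivAt (f := F) (f' := F')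
    (fun x hx => hF x (by rw [uIcc_of_le hab] at hx; exact ha.trans_le hx.1))
    hc'.intervalIntegrable, intervalIntegral.integral_of_le hab,
    ofReal_integral_eq_lintegral_ofReal hc'.intervalIntegrable.1]
  · refine setLIntegral_congr_fun measurableSet_Ioc fun x hx => ?_
    exact Real.enorm_of_nonneg (hpos x (ha.trans hx.1))
  · filter_upwards [ae_restrict_mem measurableSet_Ioc] with x hx using hpos x (ha.trans hx.1)

/-- Exhaustion from the origin, where the integrand carries no regularity. -/
lemma setLIntegral_Ioo_le {F : ℝ → ℝ≥0∞} {b : ℝ} {C : ℝ≥0∞} (hb : 0 < b)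
    (h : ∀ a, 0 < a → a ≤ b → ∫⁻ x in Ioc a b, F x ≤ C) : ∫⁻ x in Ioo 0 b, F x ≤ C := by
  have hU : Ioo 0 b ⊆ ⋃ n : ℕ, Ioc (b / (n + 1)) b := by
    intro x hx
    obtain ⟨n, hn⟩ := exists_nat_gt (b / x)
    refine mem_iUnion.2 ⟨n, ?_, hx.2.le⟩
    rw [div_lt_iff₀ hx.1] at hn
    rw [div_lt_iff₀ (by positivity)]
    nlinarith [hx.1]
  refine (lintegral_mono_set hU).trans ?_
  rw [setLIntegral_iUnion_of_directed]
  · refine iSup_le fun n => h _ (by positivity) (div_le_self hb.le ?_)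
    linarith [n.cast_nonneg (α := ℝ)]
  · refine Monotone.directed_le fun m n hmn => Ioc_subset_Ioc_left ?_
    have : (m : ℝ) ≤ n := by exact_mod_cast hmn
    gcongr

lemma setLIntegral_Ioi_le {F : ℝ → ℝ≥0∞} {r : ℝ} {C : ℝ≥0∞}
    (h : ∀ R, r ≤ R → ∫⁻ x in Ioc r R, F x ≤ C) : ∫⁻ x in Ioi r, F x ≤ C := by
  have hU : Ioi r ⊆ ⋃ n : ℕ, Ioc r (r + n) := by
    intro x hx
    obtain ⟨n, hn⟩ := exists_nat_gt (x - r)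
    exact mem_iUnion.2 ⟨n, hx, by linarith⟩
  refine (lintegral_mono_set hU).trans ?_
  rw [setLIntegral_iUnion_of_directed]
  · exact iSup_le fun n => h _ (by linarith [n.cast_nonneg (α := ℝ)])
  · refine Monotone.directed_le fun m n hmn => Ioc_subset_Ioc_right ?_
    have : (m : ℝ) ≤ n := by exact_mod_cast hmn
    linarith

/-- A positive solution dominates the Newtonian potential of its positive source. -/
lemma RadialPoisson.lintegral_le {m : ℕ} {f f' h : ℝ → ℝ} (H : RadialPoisson m f f' h)
    (hh : ContinuousOn h (Ioi 0)) (hpos : ∀ r, 0 < r → 0 < h r) (hf : ∀ r, 0 < r → 0 < f r)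
    {r : ℝ} (hr : 0 < r) :
    ∫⁻ t in Ioi r, (ENNReal.ofReal (t ^ m))⁻¹ * moment m h t ≤ ‖f r‖ₑ := by
  have hneg : ∀ t, 0 < t → f' t < 0 := fun t ht =>
    H.deriv_neg_of_pos (R := t + 1) (fun x hx => hpos x hx.1) t ⟨ht, by linarith⟩
  have h1 : ∀ t, 0 < t → (ENNReal.ofReal (t ^ m))⁻¹ * moment m h t ≤ ‖-f' t‖ₑ := by
    intro t ht
    rw [← inv_ofReal_mul_enorm (y := -f' t) (pow_pos ht m)]
    refine mul_le_mul_right (setLIntegral_Ioo_le ht fun a ha hat => ?_) _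
    rw [lintegral_eq_ofReal_sub ha hat (F := fun r => -(r ^ m * f' r))
      (F' := fun r => r ^ m * h r)
      (fun x hx => (H.hasDerivAt_flux x hx).fun_neg.congr_deriv (neg_neg _))
      ((continuousOn_id.pow m).mul hh) (fun x hx => (mul_pos (pow_pos hx m) (hpos x hx)).le)]
    have h0 := mul_neg_of_pos_of_neg (pow_pos ha m) (hneg a ha)
    have h2 := mul_neg_of_pos_of_neg (pow_pos ht m) (hneg t ht)
    rw [mul_neg, Real.enorm_of_nonneg (by linarith)]
    exact ENNReal.ofReal_le_ofReal (by linarith)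
  refine setLIntegral_Ioi_le fun R hR => ?_
  refine (setLIntegral_mono' measurableSet_Ioc fun t ht => h1 t (hr.trans ht.1)).trans ?_
  rw [lintegral_eq_ofReal_sub hr hR (F := fun r => -f r) (F' := fun r => -f' r)
    (fun x hx => (H.hasDerivAt x hx).neg) H.continuousOn_deriv.neg
    (fun x hx => by linarith [hneg x hx]), Real.enorm_of_nonneg (hf r hr).le]
  exact ENNReal.ofReal_le_ofReal (by linarith [hf R (hr.trans_le hR)])

lemma aemeasurable_potential (m : ℕ) (h : ℝ → ℝ) :
    AEMeasurable (fun t => (ENNReal.ofReal (t ^ m))⁻¹ * moment m h t)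
      (volume.restrict (Ioi (0 : ℝ))) := by
  have h1 : Measurable fun t : ℝ => (ENNReal.ofReal (t ^ m))⁻¹ := by fun_prop
  exact (h1.mul (moment_mono m h).measurable).aemeasurable

lemma RadialPoisson.lintegral_enorm_mul_le {m : ℕ} {f f' h x : ℝ → ℝ} (H : RadialPoisson m f f' h)
    (hh : ContinuousOn h (Ioi 0)) (hf : Tendsto f atTop (𝓝 0)) (hx : ContinuousOn x (Ioi 0))
    (j : ℕ) :
    ∫⁻ r in Ioi 0, ‖r ^ j * x r‖ₑ * ‖f r‖ₑ ≤
      ∫⁻ t in Ioi 0, moment j x t * ((ENNReal.ofReal (t ^ m))⁻¹ * moment m h t) := by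
  refine le_trans ?_ (lintegral_mul_lintegral_Ioi_swap (aemeasurable_enorm_pow_mul hx j)
    (aemeasurable_potential m h)).le
  exact setLIntegral_mono' measurableSet_Ioi fun r hr => mul_le_mul_right (H.enorm_le hh hf hr) _

lemma RadialPoisson.le_lintegral_enorm_mul {m : ℕ} {f f' h x : ℝ → ℝ} (H : RadialPoisson m f f' h)
    (hh : ContinuousOn h (Ioi 0)) (hpos : ∀ r, 0 < r → 0 < h r) (hf : ∀ r, 0 < r → 0 < f r)
    (hx : ContinuousOn x (Ioi 0)) (j : ℕ) :
    ∫⁻ t in Ioi 0, moment j x t * ((ENNReal.ofReal (t ^ m))⁻¹ * moment m h t) ≤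
      ∫⁻ r in Ioi 0, ‖r ^ j * x r‖ₑ * ‖f r‖ₑ := by
  refine (lintegral_mul_lintegral_Ioi_swap (aemeasurable_enorm_pow_mul hx j)
    (aemeasurable_potential m h)).ge.trans ?_
  exact setLIntegral_mono' measurableSet_Ioi
    fun r hr => mul_le_mul_right (H.lintegral_le hh hpos hf hr) _

/-- The potential in dimension `n + 2 k` is dominated by that in dimension `n`. -/
lemma potential_le (n k : ℕ) (x y : ℝ → ℝ) {t : ℝ} (ht : 0 < t) :
    moment (n + k) x t * ((ENNReal.ofReal (t ^ (n + 2 * k)))⁻¹ * moment (n + 2 * k) y t) ≤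
      (ENNReal.ofReal (t ^ k))⁻¹ * moment (n + k) x t *
        ((ENNReal.ofReal (t ^ n))⁻¹ * moment (n + k) y t) := by
  set c := ENNReal.ofReal (t ^ k) with hc
  have hc0 : c ≠ 0 := by simpa [hc] using pow_pos ht k
  have hct : c ≠ ∞ := ENNReal.ofReal_ne_top
  have e : (ENNReal.ofReal (t ^ (n + 2 * k)))⁻¹ = (ENNReal.ofReal (t ^ n))⁻¹ * (c⁻¹ * c⁻¹) := by
    rw [pow_add, two_mul, pow_add, ENNReal.ofReal_mul (by positivity),
      ENNReal.ofReal_mul (by positivity), 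
      ENNReal.mul_inv (Or.inr (ENNReal.mul_ne_top hct hct)) (Or.inl ENNReal.ofReal_ne_top),
      ENNReal.mul_inv (Or.inl hc0) (Or.inl hct)]
  have hy : moment (n + 2 * k) y t ≤ c * moment (n + k) y t := by
    have := moment_add_le (n + k) k y t
    rwa [show n + k + k = n + 2 * k by ring] at this
  rw [e]
  calc _ ≤ moment (n + k) x t * ((ENNReal.ofReal (t ^ n))⁻¹ * (c⁻¹ * c⁻¹) *
        (c * moment (n + k) y t)) := by gcongr
    _ = c⁻¹ * moment (n + k) x t * ((ENNReal.ofReal (t ^ n))⁻¹ * moment (n + k) y t) *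
        (c⁻¹ * c) := by ring
    _ = _ := by rw [ENNReal.inv_mul_cancel hc0 hct, mul_one]

lemma inv_mul_moment_le (n k : ℕ) (x : ℝ → ℝ) {t : ℝ} (ht : 0 < t) :
    (ENNReal.ofReal (t ^ k))⁻¹ * moment (n + k) x t ≤ moment n x t := by
  have hc0 : ENNReal.ofReal (t ^ k) ≠ 0 := by simpa using pow_pos ht k
  refine (mul_le_mul_right (moment_add_le n k x t) _).trans_eq ?_
  rw [← mul_assoc, ENNReal.inv_mul_cancel hc0 ENNReal.ofReal_ne_top, one_mul]

/-- The roles of `x` and `y` are exchanged on the right, so that integration in `t` yields the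
potential of `x` in the lower dimension, paired with `y`. -/
lemma potential_le_potential (n k : ℕ) (x y : ℝ → ℝ) {t : ℝ} (ht : 0 < t) :
    moment (n + k) x t * ((ENNReal.ofReal (t ^ (n + 2 * k)))⁻¹ * moment (n + 2 * k) y t) ≤
      moment (n + k) y t * ((ENNReal.ofReal (t ^ n))⁻¹ * moment n x t) := by
  refine (potential_le n k x y ht).trans ?_
  calc _ ≤ moment n x t * ((ENNReal.ofReal (t ^ n))⁻¹ * moment (n + k) y t) :=
        mul_le_mul_left (inv_mul_moment_le n k x ht) _
    _ = _ := by ring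

/-- Strictness comes from `r^k < t^k` on `(0, t)`, applied to the nowhere vanishing density `x`. -/
lemma potential_lt_potential {n k : ℕ} (hk : k ≠ 0) {x y : ℝ → ℝ} {t : ℝ} (ht : 0 < t)
    (hx : ContinuousOn x (Ioi 0)) (hx0 : ∀ r, 0 < r → x r ≠ 0) (hy : moment (n + k) y t ≠ 0)
    (hfin : moment (n + k) y t * ((ENNReal.ofReal (t ^ n))⁻¹ * moment n x t) ≠ ∞) :
    moment (n + k) x t * ((ENNReal.ofReal (t ^ (n + 2 * k)))⁻¹ * moment (n + 2 * k) y t) <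
      moment (n + k) y t * ((ENNReal.ofReal (t ^ n))⁻¹ * moment n x t) := by
  have hd0 : (ENNReal.ofReal (t ^ n))⁻¹ ≠ 0 := ENNReal.inv_ne_zero.2 ENNReal.ofReal_ne_top
  have hn0 : ENNReal.ofReal (t ^ n) ≠ 0 := by simpa using pow_pos ht n
  have hc0 : ENNReal.ofReal (t ^ k) ≠ 0 := by simpa using pow_pos ht k
  have hX : moment n x t ≠ ∞ := by
    intro h
    rw [h, ENNReal.mul_top hd0, ENNReal.mul_top hy] at hfin
    exact hfin rfl
  have hlt : (ENNReal.ofReal (t ^ k))⁻¹ * moment (n + k) x t < moment n x t := by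
    have := ENNReal.mul_lt_mul_right (ENNReal.inv_ne_zero.2 ENNReal.ofReal_ne_top)
      (ENNReal.inv_ne_top.2 hc0) (moment_add_lt (j := n) hk ht hx hx0 hX)
    rwa [← mul_assoc, ENNReal.inv_mul_cancel hc0 ENNReal.ofReal_ne_top, one_mul] at this
  have hX0 : moment n x t ≠ 0 := (bot_le.trans_lt hlt).ne'
  have hY : moment (n + k) y t ≠ ∞ := by
    intro h
    rw [h, ENNReal.top_mul (mul_ne_zero hd0 hX0)] at hfin
    exact hfin rfl
  refine (potential_le n k x y ht).trans_lt ?_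
  calc _ < moment n x t * ((ENNReal.ofReal (t ^ n))⁻¹ * moment (n + k) y t) :=
        ENNReal.mul_lt_mul_left (mul_ne_zero hd0 hy)
          (ENNReal.mul_ne_top (ENNReal.inv_ne_top.2 hn0) hY) hlt
    _ = _ := by ring

/-- Perron-Frobenius comparison: if a cooperative linear system has a positive solution in
dimension `n + 1`, then it has no nontrivial decaying solution in dimension `n + 2 k + 1`. -/
lemma eq_zero_of_pos_solution {n k : ℕ} (hk : k ≠ 0) {a b A B f g A' B' f' g' : ℝ → ℝ}
    (ha : ∀ r, 0 < r → 0 < a r) (hb : ∀ r, 0 < r → 0 < b r)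
    (hac : ContinuousOn a (Ioi 0)) (hbc : ContinuousOn b (Ioi 0))
    (hA : ∀ r, 0 < r → 0 < A r) (hB : ∀ r, 0 < r → 0 < B r)
    (HA : RadialPoisson n A A' (fun r => a r * B r))
    (HB : RadialPoisson n B B' (fun r => b r * A r))
    (Hf : RadialPoisson (n + 2 * k) f f' (fun r => a r * g r))
    (Hg : RadialPoisson (n + 2 * k) g g' (fun r => b r * f r))
    (hf : Tendsto f atTop (𝓝 0)) (hg : Tendsto g atTop (𝓝 0))
    (hfin : ∫⁻ r in Ioi 0, ‖r ^ (n + k) * (b r * A r)‖ₑ * ‖f r‖ₑ ≠ ∞) {r : ℝ} (hr : 0 < r) :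
    f r = 0 := by
  have hx : ContinuousOn (fun r => b r * A r) (Ioi 0) := hbc.mul HA.continuousOn
  have hx' : ContinuousOn (fun r => a r * B r) (Ioi 0) := hac.mul HB.continuousOn
  have hy : ContinuousOn (fun r => a r * g r) (Ioi 0) := hac.mul Hg.continuousOn
  have hy' : ContinuousOn (fun r => b r * f r) (Ioi 0) := hbc.mul Hf.continuousOn
  have hxp : ∀ r, 0 < r → 0 < b r * A r := fun r hr => mul_pos (hb r hr) (hA r hr)
  have hxp' : ∀ r, 0 < r → 0 < a r * B r := fun r hr => mul_pos (ha r hr) (hB r hr)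
  -- With weight `r^(n+k)`, `s1`–`s3` bound the pairing of `b A` with `|f|` by that of `a |g|` with
  -- `B`, and `s4`–`s6` bound the pairing of `a B` with `|g|` by that of `b |f|` with `A`. By `e1`
  -- and `e2` the chain closes up.
  have s1 := Hf.lintegral_enorm_mul_le hy hf hx (n + k)
  have s2 := setLIntegral_mono' (μ := volume) measurableSet_Ioi fun t (ht : t ∈ Ioi (0 : ℝ)) =>
    potential_le_potential n k (fun r => b r * A r) (fun r => a r * g r) ht
  have s3 := HB.le_lintegral_enorm_mul hx hxp hB hy (n + k)
  have s4 := Hg.lintegral_enorm_mul_le hy' hg hx' (n + k)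
  have s5 := setLIntegral_mono' (μ := volume) measurableSet_Ioi fun t (ht : t ∈ Ioi (0 : ℝ)) =>
    potential_le_potential n k (fun r => a r * B r) (fun r => b r * f r) ht
  have s6 := HA.le_lintegral_enorm_mul hx' hxp' hA hy' (n + k)
  have e1 : ∀ r : ℝ, ‖r ^ (n + k) * (a r * g r)‖ₑ * ‖B r‖ₑ
      = ‖r ^ (n + k) * (a r * B r)‖ₑ * ‖g r‖ₑ := fun r => by
    rw [← enorm_mul, ← enorm_mul]; congr 1; ring
  have e2 : ∀ r : ℝ, ‖r ^ (n + k) * (b r * f r)‖ₑ * ‖A r‖ₑ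
      = ‖r ^ (n + k) * (b r * A r)‖ₑ * ‖f r‖ₑ := fun r => by
    rw [← enorm_mul, ← enorm_mul]; congr 1; ring
  simp only [e1] at s3
  simp only [e2] at s6
  have hback := s3.trans (s4.trans (s5.trans s6))
  have hmeas : AEMeasurable (fun t => moment (n + k) (fun r => a r * g r) t *
      ((ENNReal.ofReal (t ^ n))⁻¹ * moment n (fun r => b r * A r) t))
      (volume.restrict (Ioi (0 : ℝ))) :=
    (moment_mono _ _).measurable.aemeasurable.mul (aemeasurable_potential _ _)
  have hfin' := ne_top_of_le_ne_top hfin hback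
  -- The closed chain of finite quantities consists of equalities, so the pointwise comparison of
  -- potentials is an equality almost everywhere. Strictness then forces the moments of `a g`, and
  -- hence `f`, to vanish.
  have hae := ae_eq_of_ae_le_of_lintegral_le
    ((ae_restrict_mem measurableSet_Ioi).mono fun t (ht : 0 < t) =>
      potential_le_potential n k (fun r => b r * A r) (fun r => a r * g r) ht)
    (ne_top_of_le_ne_top hfin' s2) hmeas (hback.trans s1)
  have hzero : ∀ᵐ t ∂(volume.restrict (Ioi (0 : ℝ))),
      moment (n + k) (fun r => a r * g r) t = 0 := by
    filter_upwards [hae, ae_lt_top' hmeas hfin', ae_restrict_mem measurableSet_Ioi] with t h1 h2 ht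
    by_contra hne
    exact (potential_lt_potential hk ht hx (fun r hr => (hxp r hr).ne') hne h2.ne).ne h1
  have h0 : ∫⁻ t in Ioi r, (ENNReal.ofReal (t ^ (n + 2 * k)))⁻¹ *
      moment (n + 2 * k) (fun r => a r * g r) t = 0 := by
    rw [← lintegral_zero (μ := volume.restrict (Ioi r))]
    refine lintegral_congr_ae ?_
    filter_upwards [ae_restrict_of_ae_restrict_of_subset (Ioi_subset_Ioi hr.le) hzero] with t ht
    have := moment_add_le (n + k) k (fun r => a r * g r) t
    rw [ht, mul_zero, show n + k + k = n + 2 * k by ring] at this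
    rw [le_zero_iff.1 this, mul_zero]
  have := Hf.enorm_le hy hf hr
  rw [h0] at this
  exact enorm_eq_zero.1 (le_zero_iff.1 this)

lemma lintegral_enorm_ne_top {F : ℝ → ℝ} {c C : ℝ} (hF : ContinuousOn F (Ioi 0))
    (h0 : Tendsto F (𝓝[>] 0) (𝓝 c)) (hi : ∀ᶠ r in atTop, |F r| ≤ C * r ^ (-2 : ℝ)) :
    ∫⁻ r in Ioi 0, ‖F r‖ₑ ≠ ∞ := by
  have h1 : F =O[atTop] fun r : ℝ => r ^ (-2 : ℝ) := by
    refine Asymptotics.IsBigO.of_bound C ?_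
    filter_upwards [hi, eventually_gt_atTop 0] with r hr hr0
    rwa [Real.norm_eq_abs, Real.norm_of_nonneg (by positivity)]
  have h2 : F =O[𝓝[>] 0] fun r : ℝ => r ^ (-0 : ℝ) := by
    simpa using h0.isBigO_one ℝ
  -- At `s = 1` the Mellin weight `r^(s-1)` is `1`, and `0 < 1 < 2` compares it with the rates at
  -- the origin and at infinity.
  have := mellin_convergent_of_isBigO_scalar (s := 1)
    (hF.locallyIntegrableOn measurableSet_Ioi) h1 (by norm_num) h2 one_pos
  simp only [sub_self, Real.rpow_zero, one_mul] at this
  exact this.2.ne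


/-! ### Ground states: symmetry modes, decay and the finite pairing. -/

namespace IsGroundStateProfile

variable {N : ℕ} {p q : ℝ} {u v : ℝ → ℝ}

lemma symm (H : IsGroundStateProfile N p q u v) : IsGroundStateProfile N q p v u :=
  ⟨H.contDiffOn_v, H.contDiffOn_u, H.pos_v, H.pos_u, H.deriv_v_zero, H.deriv_u_zero, H.eq_v,
    H.eq_u, H.mem_v, H.mem_u⟩

lemma isRegularProfile (H : IsGroundStateProfile N p q u v) :
    IsRegularProfile N u (fun r => v r ^ p) :=
  ⟨H.contDiffOn_u, H.deriv_u_zero, H.eq_u⟩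

lemma continuousOn (H : IsGroundStateProfile N p q u v) : ContinuousOn u (Ioi 0) :=
  H.contDiffOn_u.continuousOn.mono Ioi_subset_Ici_self

lemma tendsto_rpow (H : IsGroundStateProfile N p q u v) (s : ℝ) :
    Tendsto (fun r => v r ^ s) (𝓝[>] 0) (𝓝 (v 0 ^ s)) :=
  H.symm.isRegularProfile.tendsto_zero.rpow_const (Or.inl (H.pos_v 0 le_rfl).ne')

lemma coeff_pos (H : IsGroundStateProfile N p q u v) (hp : 0 < p) {r : ℝ} (hr : 0 < r) :
    0 < p * v r ^ (p - 1) :=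
  mul_pos hp (Real.rpow_pos_of_pos (H.pos_v r hr.le) _)

lemma continuousOn_coeff (H : IsGroundStateProfile N p q u v) :
    ContinuousOn (fun r => p * v r ^ (p - 1)) (Ioi 0) :=
  continuousOn_const.mul (H.symm.continuousOn.rpow_const
    fun r (hr : 0 < r) => Or.inl (H.pos_v r hr.le).ne')

lemma hasDerivAt_rpow (H : IsGroundStateProfile N p q u v) {r : ℝ} (hr : 0 < r) :
    HasDerivAt (fun r => v r ^ p) (p * v r ^ (p - 1) * deriv v r) r :=
  ((H.symm.isRegularProfile.hasDerivAt hr).rpow_const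
    (Or.inl (H.pos_v r hr.le).ne')).congr_deriv (by ring)

lemma radialPoisson_translation (H : IsGroundStateProfile N p q u v) (hN : 2 ≤ N) :
    RadialPoisson (N + 1) (fun r => deriv u r / r)
      (fun r => -N * deriv u r / r ^ 2 - v r ^ p / r)
      (fun r => p * v r ^ (p - 1) * (deriv v r / r)) :=
  (H.isRegularProfile.radialPoisson_deriv_div hN (H.tendsto_rpow p)
    fun _ hr => H.hasDerivAt_rpow hr).congr_right fun r _ => by ring

/-- The exponents `α = 2(p+1)/(pq-1)` and `β = 2(q+1)/(pq-1)` satisfy `2 + α = p β`, so the source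
`(2+α) v^p + r (v^p)'` factors as `p v^(p-1) (r v' + β v)`. -/
lemma radialPoisson_dilation (H : IsGroundStateProfile N p q u v) (hN : 2 ≤ N)
    (hpq : p * q - 1 ≠ 0) :
    RadialPoisson (N - 1) (fun r => r * deriv u r + 2 * (p + 1) / (p * q - 1) * u r)
      (fun r => (2 - N + 2 * (p + 1) / (p * q - 1)) * deriv u r - r * v r ^ p)
      (fun r => p * v r ^ (p - 1) * (r * deriv v r + 2 * (q + 1) / (p * q - 1) * v r)) := by
  refine (H.isRegularProfile.radialPoisson_dilation hN (H.tendsto_rpow p)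
    (fun _ hr => H.hasDerivAt_rpow hr) (2 * (p + 1) / (p * q - 1))).congr_right fun r hr => ?_
  have hv := H.pos_v r hr.le
  have e : v r ^ p = v r ^ (p - 1) * v r := by
    rw [← Real.rpow_add_one hv.ne', sub_add_cancel]
  rw [e]
  field_simp
  ring

lemma deriv_neg (H : IsGroundStateProfile N p q u v) (hN : 2 ≤ N) {r : ℝ} (hr : 0 < r) :
    deriv u r < 0 :=
  H.isRegularProfile.deriv_neg hN (fun r hr => Real.rpow_pos_of_pos (H.pos_v r hr.le) p) hr

lemma abs_mul_deriv_le (H : IsGroundStateProfile N p q u v) (hN : 3 ≤ N) {r : ℝ} (hr : 0 < r) :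
    |r * deriv u r| ≤ (N - 2) * u r := by
  have h1 := mul_neg_of_pos_of_neg hr (H.deriv_neg (by omega) hr)
  rw [abs_of_neg h1]
  exact H.isRegularProfile.neg_mul_deriv_le hN
    (fun r hr => Real.rpow_pos_of_pos (H.pos_v r hr.le) p) (fun r hr => H.pos_u r hr.le) hr

lemma decay (H : IsGroundStateProfile N p q u v) (hN : 3 ≤ N) (hp : 0 < p) (hq : 0 < q)
    (hpq : 1 / (p + 1) + 1 / (q + 1) = ((N : ℝ) - 2) / (N : ℝ)) :
    ∃ C, ∀ᶠ r in atTop, |u r| ≤ C * r ^ (-((N : ℝ) / (q + 1))) :=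
  H.mem_u.decay hN hp hq hpq H.continuousOn

lemma tendsto_atTop (H : IsGroundStateProfile N p q u v) (hN : 3 ≤ N) (hp : 0 < p) (hq : 0 < q)
    (hpq : 1 / (p + 1) + 1 / (q + 1) = ((N : ℝ) - 2) / (N : ℝ)) : Tendsto u atTop (𝓝 0) := by
  have hN0 : (0 : ℝ) < N := by exact_mod_cast (by omega : 0 < N)
  obtain ⟨C, hC⟩ := H.decay hN hp hq hpq
  exact tendsto_zero_of_decay (by positivity) hC

lemma tendsto_mul_deriv_atTop (H : IsGroundStateProfile N p q u v) (hN : 3 ≤ N) (hp : 0 < p)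
    (hq : 0 < q) (hpq : 1 / (p + 1) + 1 / (q + 1) = ((N : ℝ) - 2) / (N : ℝ)) :
    Tendsto (fun r => r * deriv u r) atTop (𝓝 0) := by
  refine squeeze_zero_norm' (a := fun r => ((N : ℝ) - 2) * u r) ?_ ?_
  · filter_upwards [eventually_gt_atTop 0] with r hr using H.abs_mul_deriv_le hN hr
  · simpa using (H.tendsto_atTop hN hp hq hpq).const_mul ((N : ℝ) - 2)

/-- The pairing of the translation mode with a function in the energy space is finite. -/
lemma lintegral_pairing_ne_top (H : IsGroundStateProfile N p q u v) (hN : 3 ≤ N) (hp : 0 < p)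
    (hq : 0 < q) (hpq : 1 / (p + 1) + 1 / (q + 1) = ((N : ℝ) - 2) / (N : ℝ)) {k : ℕ}
    {ψ : ℝ → ℝ} {ψ₀ : ℝ} (hψ : MemEnergySpace N (k + 1) ((p + 1) / p) ψ)
    (hψc : ContinuousOn ψ (Ioi 0))
    (hψ0 : Tendsto (fun r => ψ r / r ^ (k + 1)) (𝓝[>] 0) (𝓝 ψ₀)) :
    ∫⁻ r in Ioi 0, ‖r ^ (N + 1 + k) * (q * u r ^ (q - 1) * -(deriv u r / r))‖ₑ *
      ‖ψ r / r ^ (k + 1)‖ₑ ≠ ∞ := by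
  simp only [← enorm_mul]
  have hN0 : (0 : ℝ) < N := by exact_mod_cast (by omega : 0 < N)
  have hd : ContinuousOn (fun r => deriv u r / r) (Ioi 0) :=
    (H.radialPoisson_translation (by omega)).continuousOn
  obtain ⟨C₁, hC₁⟩ := H.decay hN hp hq hpq
  obtain ⟨C₂, hC₂⟩ := hψ.decay hN hp hq hpq hψc
  -- The integrand is, up to sign, `q r^(N-2) u^(q-1) (r u') ψ`. Since `|r u'| ≤ (N-2) u`, the decay
  -- of `u` and `ψ` gives the power `N - 2 - (q+1) · N/(q+1) = -2`.
  refine lintegral_enorm_ne_top (c := 0) (C := q * (N - 2) * (C₁ ^ q * C₂)) ?_ ?_ ?_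
  · exact ((continuousOn_id.pow _).mul (H.symm.continuousOn_coeff.mul hd.neg)).mul
      (hψc.div (continuousOn_id.pow _) fun r hr => pow_ne_zero _ (ne_of_gt hr))
  · have h1 := (((H.symm.tendsto_rpow (q - 1)).const_mul q).mul
      (H.isRegularProfile.tendsto_deriv_div (by omega) (H.tendsto_rpow p)).neg).mul hψ0
    refine (IsRegularProfile.tendsto_pow_mul_zero (N + k) h1).congr fun r => ?_
    rw [show N + 1 + k = N + k + 1 by ring]
    ring
  · filter_upwards [hC₁, hC₂, eventually_gt_atTop 0] with r h1 h2 hr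
    have hu := H.pos_u r hr.le
    set κ := (N : ℝ) / (q + 1) with hκ
    have hrκ : 0 < r ^ (-κ) := Real.rpow_pos_of_pos hr _
    rw [abs_of_pos hu] at h1
    have hC₁0 : 0 ≤ C₁ := by
      by_contra! hlt
      exact absurd (hu.trans_le h1) (not_lt.2 (mul_neg_of_neg_of_pos hlt hrκ).le)
    obtain ⟨n, rfl⟩ : ∃ n, N = n + 3 := ⟨N - 3, by omega⟩
    have hn : ((n + 3 : ℕ) : ℝ) - 2 = n + 1 := by push_cast; ring
    have e1 : r ^ (n + 3 + 1 + k) * (q * u r ^ (q - 1) * -(deriv u r / r)) * (ψ r / r ^ (k + 1))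
        = q * r ^ (n + 1) * u r ^ (q - 1) * (-(r * deriv u r)) * ψ r := by
      field_simp
      ring
    have hle := H.abs_mul_deriv_le hN hr
    rw [e1, abs_mul, abs_mul, abs_neg, abs_of_pos (by positivity)]
    have huq : u r ^ q ≤ C₁ ^ q * (r ^ (-κ)) ^ q := by
      rw [← Real.mul_rpow hC₁0 hrκ.le]
      exact Real.rpow_le_rpow hu.le h1 hq.le
    have euq : u r ^ (q - 1) * u r = u r ^ q := by
      rw [← Real.rpow_add_one hu.ne', sub_add_cancel]
    calc q * r ^ (n + 1) * u r ^ (q - 1) * |r * deriv u r| * |ψ r|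
        ≤ q * r ^ (n + 1) * u r ^ (q - 1) * ((((n + 3 : ℕ) : ℝ) - 2) * u r) *
          (C₂ * r ^ (-κ)) := by
          rw [hn] at hle ⊢
          gcongr
      _ = q * (((n + 3 : ℕ) : ℝ) - 2) * r ^ (n + 1) * (u r ^ (q - 1) * u r) *
          (C₂ * r ^ (-κ)) := by ring
      _ ≤ q * (((n + 3 : ℕ) : ℝ) - 2) * r ^ (n + 1) * (C₁ ^ q * (r ^ (-κ)) ^ q) *
          (C₂ * r ^ (-κ)) := by
          rw [euq, hn]
          have : 0 ≤ C₂ * r ^ (-κ) := (abs_nonneg _).trans h2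
          gcongr
      _ = q * (((n + 3 : ℕ) : ℝ) - 2) * (C₁ ^ q * C₂) *
          (r ^ (n + 1) * ((r ^ (-κ)) ^ q * r ^ (-κ))) := by ring
      _ = _ := by
          congr 1
          rw [← Real.rpow_mul hr.le, ← Real.rpow_add hr, ← Real.rpow_natCast, ← Real.rpow_add hr]
          congr 1
          rw [hκ]
          push_cast
          field_simp
          ring

end IsGroundStateProfile

lemma MemEnergySpace.tendsto_atTop {N ℓ : ℕ} {p q : ℝ} (hN : 3 ≤ N) (hp : 0 < p) (hq : 0 < q)
    (hpq : 1 / (p + 1) + 1 / (q + 1) = ((N : ℝ) - 2) / (N : ℝ)) {f : ℝ → ℝ}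
    (hf : MemEnergySpace N ℓ ((p + 1) / p) f) (hfc : ContinuousOn f (Ioi 0)) :
    Tendsto f atTop (𝓝 0) := by
  have hN0 : (0 : ℝ) < N := by exact_mod_cast (by omega : 0 < N)
  obtain ⟨C, hC⟩ := hf.decay hN hp hq hpq hfc
  exact tendsto_zero_of_decay (by positivity) hC

lemma tendsto_div_pow_atTop {f : ℝ → ℝ} (ℓ : ℕ) (hf : Tendsto f atTop (𝓝 0)) :
    Tendsto (fun r => f r / r ^ ℓ) atTop (𝓝 0) := by
  refine squeeze_zero_norm' ?_ (by simpa using hf.norm)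
  filter_upwards [eventually_ge_atTop 1] with r hr
  rw [norm_div, norm_pow, Real.norm_of_nonneg (zero_le_one.trans hr)]
  exact div_le_self (norm_nonneg _) (one_le_pow₀ hr)

/-! ### The three cases `ℓ = 0`, `ℓ = 1` and `ℓ ≥ 2`. -/

section Sectors

variable {N : ℕ} {p q : ℝ} {u v : ℝ → ℝ} {ℓ : ℕ} {ψ φ : ℝ → ℝ}

lemma IsLinearizedSolution.eq_dilation (hN : 3 ≤ N) (hp : 0 < p) (hq : 0 < q)
    (hpq : 1 / (p + 1) + 1 / (q + 1) = ((N : ℝ) - 2) / (N : ℝ))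
    (huv : IsGroundStateProfile N p q u v)
    (hψ : MemEnergySpace N 0 ((p + 1) / p) ψ) (hsol : IsLinearizedSolution N 0 p q u v ψ φ)
    (hψ0 : RegularAtOrigin 0 ψ) (hφ0 : RegularAtOrigin 0 φ) :
    ∃ c : ℝ, ∀ r, 0 < r →
      ψ r = c * (r * deriv u r + 2 * (p + 1) / (p * q - 1) * u r) ∧
      φ r = c * (r * deriv v r + 2 * (q + 1) / (p * q - 1) * v r) := by
  have h1 := one_lt_mul_of_critical hN hp hq hpq
  have hne : p * q - 1 ≠ 0 := by linarith
  have hfst := hsol.radialPoisson_fst (by omega) hψ0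
  have hsnd := hsol.symm.radialPoisson_fst (by omega) hφ0
  have hdu := huv.radialPoisson_dilation (by omega) hne
  have hdv := huv.symm.radialPoisson_dilation (by omega) (by rwa [mul_comm q p])
  obtain ⟨ψ₀, hψ₀⟩ := hψ0.1
  obtain ⟨φ₀, hφ₀⟩ := hφ0.1
  simp only [mul_zero, add_zero, pow_zero, div_one] at hfst hsnd hψ₀ hφ₀
  simp only [mul_comm q p] at hdv
  have hlim : ∀ {p q : ℝ} {u v : ℝ → ℝ}, IsGroundStateProfile N p q u v → ∀ α : ℝ,
      Tendsto (fun r => r * deriv u r + α * u r) (𝓝[>] 0) (𝓝 (α * u 0)) := by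
    intro p q u v H α
    have := (tendsto_nhdsWithin_of_tendsto_nhds (s := Ioi 0)
      (continuous_id (X := ℝ)).continuousAt.tendsto).mul H.isRegularProfile.tendsto_deriv_zero
    simpa using this.add (H.isRegularProfile.tendsto_zero.const_mul α)
  refine exists_eq_const_mul (ℓ := 0) (fun r hr => huv.coeff_pos hp hr)
    (fun r hr => huv.symm.coeff_pos hq hr) huv.continuousOn_coeff huv.symm.continuousOn_coeff
    ((huv.tendsto_rpow (p - 1)).const_mul p) ((huv.symm.tendsto_rpow (q - 1)).const_mul q)
    hfst hsnd hdu hdv hψ₀ hφ₀ (hlim huv _) (hlim huv.symm _) ?_ ?_ ?_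
  -- Nonvanishing at the origin of the dilation mode, whose value there is a positive multiple of `u
  -- 0` because `p q > 1`.
  · have : 0 < p * q - 1 := by linarith
    have := huv.pos_u 0 le_rfl
    positivity
  · simpa using hψ.tendsto_atTop hN hp hq hpq hsol.contDiffOn_fst.continuousOn
  · simpa using (huv.tendsto_mul_deriv_atTop hN hp hq hpq).add
      ((huv.tendsto_atTop hN hp hq hpq).const_mul (2 * (p + 1) / (p * q - 1)))

lemma IsLinearizedSolution.eq_translation (hN : 3 ≤ N) (hp : 0 < p) (hq : 0 < q)
    (hpq : 1 / (p + 1) + 1 / (q + 1) = ((N : ℝ) - 2) / (N : ℝ))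
    (huv : IsGroundStateProfile N p q u v)
    (hψ : MemEnergySpace N 1 ((p + 1) / p) ψ) (hsol : IsLinearizedSolution N 1 p q u v ψ φ)
    (hψ0 : RegularAtOrigin 1 ψ) (hφ0 : RegularAtOrigin 1 φ) :
    ∃ c : ℝ, ∀ r, 0 < r → ψ r = c * deriv u r ∧ φ r = c * deriv v r := by
  have hN0 : (0 : ℝ) < N := by exact_mod_cast (by omega : 0 < N)
  have hfst := hsol.radialPoisson_fst (by omega) hψ0
  have hsnd := hsol.symm.radialPoisson_fst (by omega) hφ0
  obtain ⟨ψ₀, hψ₀⟩ := hψ0.1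
  obtain ⟨φ₀, hφ₀⟩ := hφ0.1
  rw [show N - 1 + 2 * 1 = N + 1 by omega] at hfst hsnd
  simp only [pow_one] at hfst hsnd hψ₀ hφ₀
  have hv0 : 0 < v 0 ^ p := Real.rpow_pos_of_pos (huv.pos_v 0 le_rfl) p
  have hψi : Tendsto (fun r => r ^ 1 * (ψ r / r)) atTop (𝓝 0) := by
    refine (hψ.tendsto_atTop hN hp hq hpq hsol.contDiffOn_fst.continuousOn).congr' ?_
    filter_upwards [eventually_gt_atTop 0] with r hr
    field_simp
  have hui : Tendsto (fun r => r ^ 1 * (deriv u r / r)) atTop (𝓝 0) := by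
    refine (tendsto_div_pow_atTop 1 (huv.tendsto_mul_deriv_atTop hN hp hq hpq)).congr' ?_
    filter_upwards [eventually_gt_atTop 0] with r hr
    field_simp
  obtain ⟨c, hc⟩ := exists_eq_const_mul (ℓ := 1) (fun r hr => huv.coeff_pos hp hr)
    (fun r hr => huv.symm.coeff_pos hq hr) huv.continuousOn_coeff huv.symm.continuousOn_coeff
    ((huv.tendsto_rpow (p - 1)).const_mul p) ((huv.symm.tendsto_rpow (q - 1)).const_mul q)
    hfst hsnd (huv.radialPoisson_translation (by omega))
    (huv.symm.radialPoisson_translation (by omega)) hψ₀ hφ₀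
    (huv.isRegularProfile.tendsto_deriv_div (by omega) (huv.tendsto_rpow p))
    (huv.symm.isRegularProfile.tendsto_deriv_div (by omega) (huv.symm.tendsto_rpow q))
    (div_ne_zero (neg_ne_zero.2 hv0.ne') hN0.ne')
    hψi hui
  refine ⟨c, fun r hr => ?_⟩
  obtain ⟨h1, h2⟩ := hc r hr
  field_simp at h1 h2
  exact ⟨h1, h2⟩

lemma IsLinearizedSolution.fst_eq_zero (hN : 3 ≤ N) (hp : 0 < p) (hq : 0 < q)
    (hpq : 1 / (p + 1) + 1 / (q + 1) = ((N : ℝ) - 2) / (N : ℝ))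
    (huv : IsGroundStateProfile N p q u v) (hℓ : 2 ≤ ℓ)
    (hψ : MemEnergySpace N ℓ ((p + 1) / p) ψ) (hφ : MemEnergySpace N ℓ ((q + 1) / q) φ)
    (hsol : IsLinearizedSolution N ℓ p q u v ψ φ)
    (hψ0 : RegularAtOrigin ℓ ψ) (hφ0 : RegularAtOrigin ℓ φ) {r : ℝ} (hr : 0 < r) :
    ψ r = 0 := by
  obtain ⟨k, rfl⟩ : ∃ k, ℓ = k + 1 := ⟨ℓ - 1, by omega⟩
  have hfst := hsol.radialPoisson_fst (by omega) hψ0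
  have hsnd := hsol.symm.radialPoisson_fst (by omega) hφ0
  -- With `ℓ = k + 1`, the solution lives `2k` dimensions above the translation mode, and `ℓ ≥ 2`
  -- means `k ≠ 0`.
  rw [show N - 1 + 2 * (k + 1) = N + 1 + 2 * k by omega] at hfst hsnd
  have hpq' : 1 / (q + 1) + 1 / (p + 1) = ((N : ℝ) - 2) / (N : ℝ) := by rw [add_comm, hpq]
  have hψc := hsol.contDiffOn_fst.continuousOn
  have hφc := hsol.contDiffOn_snd.continuousOn
  obtain ⟨ψ₀, hψ₀⟩ := hψ0.1
  have hpos : ∀ {p q : ℝ} {u v : ℝ → ℝ}, IsGroundStateProfile N p q u v →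
      ∀ r, 0 < r → 0 < -(deriv u r / r) := fun H r hr =>
    neg_pos.2 (div_neg_of_neg_of_pos (H.deriv_neg (by omega) hr) hr)
  have := eq_zero_of_pos_solution (k := k) (by omega) (fun r hr => huv.coeff_pos hp hr)
    (fun r hr => huv.symm.coeff_pos hq hr) huv.continuousOn_coeff huv.symm.continuousOn_coeff
    (hpos huv) (hpos huv.symm)
    ((huv.radialPoisson_translation (by omega)).neg.congr_right fun r _ => (mul_neg _ _).symm)
    ((huv.symm.radialPoisson_translation (by omega)).neg.congr_right fun r _ => (mul_neg _ _).symm)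
    hfst hsnd (tendsto_div_pow_atTop _ (hψ.tendsto_atTop hN hp hq hpq hψc))
    (tendsto_div_pow_atTop _ (hφ.tendsto_atTop hN hq hp hpq' hφc))
    (huv.lintegral_pairing_ne_top hN hp hq hpq hψ hψc hψ₀) hr
  exact (div_eq_zero_iff.1 this).resolve_right (pow_ne_zero _ hr.ne')

end Sectors

end LaneEmden

theorem proposition2p1 (N : ℕ) (hN : 3 ≤ N) (p q : ℝ) (hp : 0 < p) (hq : 0 < q)
    (hpq : 1 / (p + 1) + 1 / (q + 1) = ((N : ℝ) - 2) / (N : ℝ))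
    (u v : ℝ → ℝ) (huv : LaneEmden.IsGroundStateProfile N p q u v)
    (ℓ : ℕ) (ψ φ : ℝ → ℝ)
    (hψ : LaneEmden.MemEnergySpace N ℓ ((p + 1) / p) ψ)
    (hφ : LaneEmden.MemEnergySpace N ℓ ((q + 1) / q) φ)
    (hsol : LaneEmden.IsLinearizedSolution N ℓ p q u v ψ φ)
    (hψ0 : LaneEmden.RegularAtOrigin ℓ ψ) (hφ0 : LaneEmden.RegularAtOrigin ℓ φ) :
    (ℓ = 0 → ∃ c : ℝ, ∀ r, 0 < r →
      ψ r = c * (r * deriv u r + 2 * (p + 1) / (p * q - 1) * u r) ∧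
      φ r = c * (r * deriv v r + 2 * (q + 1) / (p * q - 1) * v r)) ∧
    (ℓ = 1 → ∃ c : ℝ, ∀ r, 0 < r → ψ r = c * deriv u r ∧ φ r = c * deriv v r) ∧
    (2 ≤ ℓ → ∀ r, 0 < r → ψ r = 0 ∧ φ r = 0) := by
  refine ⟨?_, ?_, fun hℓ r hr => ⟨?_, ?_⟩⟩
  · rintro rfl
    exact hsol.eq_dilation hN hp hq hpq huv hψ hψ0 hφ0
  · rintro rfl
    exact hsol.eq_translation hN hp hq hpq huv hψ hψ0 hφ0
  · exact hsol.fst_eq_zero hN hp hq hpq huv hℓ hψ hφ hψ0 hφ0 hr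
  -- The whole setting is symmetric under exchanging `(p, u, ψ)` and `(q, v, φ)`.
  · exact hsol.symm.fst_eq_zero hN hq hp (by rw [add_comm, hpq]) huv.symm hℓ hφ hψ hφ0 hψ0 hr
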